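/- A $(k+1)$-path in a graph $H$ is a sequence of at least $k+1$ distinct vertices in which any two vertices at positions differing by at most $k+1$ are adjacent in $H$ (a not necessarily induced copy of the $(k+1)$-st power of a path). Its end-sets are the ordered sets of its first $k+1$ and of its last $k+1$ vertices. Let $G(n,p)$ denote the binomial random graph on the vertex set $V=\{1,\dots,n\}$. **Proposition (Absorbing Lemma).** For every integer $k\ge 0$ and every real $\varepsilon>0$ there exist $\gamma\in(0,\varepsilon/4^{k+2})$ and $C>1$ such that the following holds. Let $(G_n)_{n\in\mathbb N}$ be a sequence of graphs, $G_n$ on the vertex set $\{1,\dots,n\}$, and let $p=p(n)\in[0,1]$, such that $\delta(G_n)\ge(\tfrac{k}{k+1}+\varepsilon)n$ and $p(n)\ge C/n$ for all sufficiently large $n$. Then, with probability tending to $1$ as $n\to\infty$, the graph $H=G_n\cup G(n,p)$ has the following property. For every set of vertices $R\subseteq V$ with $|R|\le\gamma^2n$, the graph $H-R$ contains a $(k+1)$-path $A$ with at most $\gamma n/2$ vertices such that for every $U\subseteq V$ with $|U|\le 2\gamma^2n$ the graph $H[V(A)\cup U]$ contains a spanning $(k+1)$-path having the same (ordered) end-sets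 as $A$. -/

import Mathlib

namespace PowerPath

/-- The list `P = (v₀, …, v_{r-1})` is (the vertex sequence of) an `m`-path in the graph `H`, that
is, of a not necessarily induced copy of the `m`-th power of a path: the vertices are distinct, and
any two of them whose positions differ by at most `m` are adjacent in `H`. There are at least `m`
vertices, so that both end-sets exist. -/
structure IsPowerPath {V : Type*} (H : SimpleGraph V) (m : ℕ) (P : List V) : Prop where
  nodup : P.Nodup
  le_length : m ≤ P.length
  adj : ∀ (i j : ℕ) (hi : i < P.length) (hj : j < P.length), i < j → j ≤ i + m → H.Adj P[i] P[j]

/-- The first end-set of an `m`-path: its first `m` vertices, in order. -/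
def firstEnd {V : Type*} (m : ℕ) (P : List V) : List V := P.take m

/-- The last end-set of an `m`-path: its last `m` vertices, in order. -/
def lastEnd {V : Type*} (m : ℕ) (P : List V) : List V := P.drop (P.length - m)

/-- With `n = |V|`: for every set `R` of at most `γ² n` vertices there is a `(k+1)`-path `A` in
`H - R` on at most `γ n / 2` vertices such that for every set `U` of at most `2 γ² n` vertices
(which may meet `A` and `R`) there is a `(k+1)`-path in `H` with vertex set exactly `V(A) ∪ U`
and with the same ordered end-sets as `A`. -/
def HasAbsorbingPaths {V : Type*} [Fintype V] (k : ℕ) (γ : ℝ) (H : SimpleGraph V) : Prop :=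
  ∀ R : Finset V, (R.card : ℝ) ≤ γ ^ 2 * (Fintype.card V : ℝ) →
    ∃ A : List V, IsPowerPath H (k + 1) A ∧ (∀ v ∈ A, v ∉ R) ∧
      (A.length : ℝ) ≤ γ * (Fintype.card V : ℝ) / 2 ∧
      ∀ U : Finset V, (U.card : ℝ) ≤ 2 * γ ^ 2 * (Fintype.card V : ℝ) →
        ∃ B : List V, IsPowerPath H (k + 1) B ∧ (∀ v, v ∈ B ↔ v ∈ A ∨ v ∈ U) ∧
          firstEnd (k + 1) B = firstEnd (k + 1) A ∧ lastEnd (k + 1) B = lastEnd (k + 1) A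

end PowerPath

/-!
Let `F` be the random graph and `m = k + 1`. Consider a family of positive density of tuples of
vertices that span an `m`-path in `G ∪ F` as soon as the pairs of a certain matching are edges of
`F`. With probability at least `1 - exp (-3 n)`, up to a polynomial factor in front of the
exponential, this happens for some injective tuple of the family. The error beats a union bound over
the at most `4 ^ n * n ^ d` families that occur.

*Connections.* The minimum degree of `G` gives any `m` vertices linearly many common neighbours. Two
cliques on `m` vertices are connected by induction on `m`: from each of them, lead into the
neighbourhood of a vertex `v`, the hub, connect inside this neighbourhood by an `(m - 1)`-path, and
make it an `m`-path by inserting, at regular distances, further vertices with the same neighbours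
on this path as `v`. Only a matching of random edges is used.

*Absorbers.* A path on `2 m` vertices in the neighbourhood of `v` that is an `m`-path of `G ∪ F`
absorbs `v` in its middle, and it needs only `m` random edges, forming a matching. By averaging,
some such path absorbs a positive proportion of any given vertex set. Choosing such paths greedily
and halving the set of uncovered vertices yields few disjoint absorbers that satisfy Hall's
condition for every small `U`. Connections join them to one path, and a matching of `U` into the
absorbers tells where to insert the vertices of `U`.
-/

namespace PowerPath

section PowerWalks

variable {α β : Type*} {r : α → α → Prop} {m : ℕ}

/-- An `m`-walk for the relation `r`: any two entries of the list whose positions differ by at most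
`m` are related. Unlike an `m`-path it may be short and may repeat vertices. -/
def IsPowerWalk (r : α → α → Prop) (m : ℕ) (l : List α) : Prop :=
  ∀ (i j : ℕ) (a b : α), i < j → j ≤ i + m → l[i]? = some a → l[j]? = some b → r a b

theorem isPowerWalk_nil : IsPowerWalk r m [] := by
  intro i j a b _ _ ha
  simp at ha

theorem isPowerWalk_cons {a : α} {l : List α} :
    IsPowerWalk r m (a :: l) ↔ (∀ b ∈ l.take m, r a b) ∧ IsPowerWalk r m l := by
  constructor
  · intro h
    refine ⟨fun b hb => ?_, fun i j c d hij hjm hc hd => ?_⟩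
    · obtain ⟨i, hi⟩ := List.mem_iff_getElem?.1 hb
      rw [List.getElem?_take] at hi
      split_ifs at hi with him
      exact h 0 (i + 1) a b (by omega) (by omega) (by simp) (by simpa using hi)
    · exact h (i + 1) (j + 1) c d (by omega) (by omega) (by simpa using hc) (by simpa using hd)
  · rintro ⟨ha, hl⟩ i j c d hij hjm hc hd
    obtain ⟨j, rfl⟩ : ∃ j', j = j' + 1 := ⟨j - 1, by omega⟩
    rw [List.getElem?_cons_succ] at hd
    rcases i with _ | i
    · obtain rfl : a = c := by simpa using hc
      exact ha d (List.mem_iff_getElem?.2 ⟨j, by rw [List.getElem?_take, if_pos (by omega), hd]⟩)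
    · exact hl i j c d (by omega) (by omega) (by simpa using hc) hd

theorem isPowerWalk_of_pairwise {l : List α} (h : l.Pairwise r) : IsPowerWalk r m l := by
  intro i j a b hij _ ha hb
  obtain ⟨hi, rfl⟩ := List.getElem?_eq_some_iff.1 ha
  obtain ⟨hj, rfl⟩ := List.getElem?_eq_some_iff.1 hb
  exact List.pairwise_iff_getElem.1 h i j hi hj hij

namespace IsPowerWalk

theorem pairwise {l : List α} (h : IsPowerWalk r m l) (hl : l.length ≤ m + 1) : l.Pairwise r := by
  rw [List.pairwise_iff_getElem]
  intro i j hi hj hij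
  exact h i j _ _ hij (by omega) (List.getElem?_eq_getElem hi) (List.getElem?_eq_getElem hj)

theorem isPowerPath {H : SimpleGraph α} {l : List α} (h : IsPowerWalk H.Adj m l) (hl : l.Nodup)
    (hm : m ≤ l.length) : IsPowerPath H m l :=
  ⟨hl, hm, fun i j hi hj hij hjm =>
    h i j _ _ hij hjm (List.getElem?_eq_getElem hi) (List.getElem?_eq_getElem hj)⟩

theorem mono_exponent {m' : ℕ} {l : List α} (h : IsPowerWalk r m l) (hm : m' ≤ m) :
    IsPowerWalk r m' l :=
  fun i j a b hij hjm => h i j a b hij (by omega)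

theorem of_isInfix {l l' : List α} (h : IsPowerWalk r m l) (hl : l' <:+: l) :
    IsPowerWalk r m l' := by
  obtain ⟨s, t, rfl⟩ := hl
  intro i j a b hij hjm ha hb
  have shift : ∀ {i a}, l'[i]? = some a → (s ++ l' ++ t)[s.length + i]? = some a := by
    intro i a hi
    have hi' := (List.getElem?_eq_some_iff.1 hi).1
    rw [List.getElem?_append_left (by simp [hi']), List.getElem?_append_right (by omega)]
    simpa using hi
  exact h _ _ a b (by omega) (by omega) (shift ha) (shift hb)

theorem reverse {l : List α} (hr : ∀ a b, r a b → r b a) (h : IsPowerWalk r m l) :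
    IsPowerWalk r m l.reverse := by
  intro i j a b hij hjm ha hb
  have hi : i < l.length := by simpa using (List.getElem?_eq_some_iff.1 ha).1
  have hj : j < l.length := by simpa using (List.getElem?_eq_some_iff.1 hb).1
  rw [List.getElem?_reverse hi] at ha
  rw [List.getElem?_reverse hj] at hb
  exact hr _ _ (h _ _ b a (by omega) (by omega) hb ha)

theorem append_of_overlap {P Q S : List α} (hPQ : IsPowerWalk r m (P ++ Q))
    (hQS : IsPowerWalk r m (Q ++ S)) (hm : m ≤ Q.length) : IsPowerWalk r m (P ++ Q ++ S) := by
  intro i j a b hij hjm ha hb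
  have hlen : (P ++ Q).length = P.length + Q.length := List.length_append
  rcases lt_or_ge j (P ++ Q).length with hj | hj
  · rw [List.getElem?_append_left (by omega)] at ha hb
    exact hPQ i j a b hij hjm ha hb
  · rw [List.append_assoc, List.getElem?_append_right (by omega)] at ha hb
    exact hQS (i - P.length) (j - P.length) a b (by omega) (by omega) ha hb

theorem concat {l : List α} {a : α} (h : IsPowerWalk r m l)
    (ha : ∀ b ∈ l.drop (l.length - m), r b a) : IsPowerWalk r m (l ++ [a]) := by
  intro i j b c hij hjm hb hc
  rcases lt_or_ge j l.length with hj | hj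
  · rw [List.getElem?_append_left (by omega)] at hb hc
    exact h i j b c hij hjm hb hc
  · rw [List.getElem?_append_right hj] at hc
    obtain ⟨hj', rfl⟩ := List.getElem?_eq_some_iff.1 hc
    rw [List.length_singleton] at hj'
    rw [List.getElem?_append_left (by omega)] at hb
    rw [List.getElem_singleton]
    refine ha b (List.mem_iff_getElem?.2 ⟨i - (l.length - m), ?_⟩)
    rwa [List.getElem?_drop, show l.length - m + (i - (l.length - m)) = i by omega]

theorem append_of_forall₂ {P Q S : List α} (hP : IsPowerWalk r (m + 1) (P ++ Q))
    (hQS : IsPowerWalk r m (P ++ Q ++ S)) (hm : Q.length = m + 1) (h : List.Forall₂ r Q S) :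
    IsPowerWalk r (m + 1) (P ++ Q ++ S) := by
  intro i j a b hij hjm ha hb
  rcases hjm.lt_or_eq with hjm | rfl
  · exact hQS i j a b hij (by omega) ha hb
  have hlen : (P ++ Q).length = P.length + Q.length := List.length_append
  rcases lt_or_ge (i + (m + 1)) (P ++ Q).length with hj | hj
  · rw [List.getElem?_append_left (by omega)] at ha hb
    exact hP i _ a b hij le_rfl ha hb
  have hS : (P ++ Q ++ S).length = P.length + Q.length + S.length := by simp; omega
  have hQS' := h.length_eq
  have hj' := (List.getElem?_eq_some_iff.1 hb).1
  rw [List.getElem?_append_right hj, List.getElem?_eq_some_iff] at hb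
  rw [List.append_assoc, List.getElem?_append_right (by omega),
    List.getElem?_append_left (by omega), List.getElem?_eq_some_iff] at ha
  obtain ⟨hi, rfl⟩ := ha
  obtain ⟨hj'', rfl⟩ := hb
  have hpos : i + (m + 1) - (P ++ Q).length = i - P.length := by omega
  simp only [hpos]
  exact h.get hi (by omega)

theorem insert {P Q S : List α} {v : α} (hP : P.length ≤ m + 1)
    (hS : S.take m = Q.take m) (hPQ : IsPowerWalk r m (P ++ Q))
    (hvS : IsPowerWalk r (m + 1) (v :: S)) (hPv : ∀ a ∈ P, r a v) :
    IsPowerWalk r (m + 1) (P ++ v :: S) := by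
  induction P with
  | nil => simpa using hvS
  | cons a P ih =>
    rw [List.cons_append, isPowerWalk_cons] at hPQ ⊢
    rw [List.length_cons] at hP
    refine ⟨fun b hb => ?_, ih (by omega) hPQ.2 fun a ha => hPv a (List.mem_cons_of_mem _ ha)⟩
    have hsplit : m + 1 - P.length = (m - P.length) + 1 := by omega
    have hSQ : S.take (m - P.length) = Q.take (m - P.length) := by
      simpa [List.take_take] using congrArg (List.take (m - P.length)) hS
    rw [List.take_append, List.take_of_length_le (by omega), hsplit, List.take_succ_cons,
      List.mem_append, List.mem_cons, hSQ] at hb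
    rw [List.take_append, List.take_of_length_le (by omega)] at hPQ
    rcases hb with hb | rfl | hb
    exacts [hPQ.1 b (List.mem_append_left _ hb), hPv a List.mem_cons_self,
      hPQ.1 b (List.mem_append_right _ hb)]

theorem insert_middle {P Q : List α} {v : α} (h : IsPowerWalk r (m + 1) (P ++ Q))
    (hP : P.length = m + 1) (hPv : ∀ a ∈ P, r a v) (hQv : ∀ a ∈ Q, r v a) :
    IsPowerWalk r (m + 1) (P ++ v :: Q) :=
  insert hP.le rfl (h.mono_exponent (by omega))
    (isPowerWalk_cons.2 ⟨fun b hb => hQv b (List.mem_of_mem_take hb),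
      h.of_isInfix (List.suffix_append P Q).isInfix⟩) hPv

end IsPowerWalk

end PowerWalks

section Insertion

open scoped List

variable {α β : Type*} {m : ℕ}

/-- Insert one entry of `vs` after each block of `m` consecutive entries of `t`. -/
def insertEvery (m : ℕ) : List α → List α → List α
  | [], t => t
  | v :: vs, t => t.take m ++ v :: insertEvery m vs (t.drop m)

theorem insertEvery_perm (m : ℕ) (vs t : List α) : insertEvery m vs t ~ vs ++ t := by
  induction vs generalizing t with
  | nil => simp [insertEvery]
  | cons v vs ih =>
    calc t.take m ++ v :: insertEvery m vs (t.drop m)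
      _ ~ v :: (t.take m ++ insertEvery m vs (t.drop m)) := List.perm_middle
      _ ~ v :: (t.take m ++ (vs ++ t.drop m)) := ((ih _).append_left _).cons v
      _ ~ v :: (vs ++ (t.take m ++ t.drop m)) := by
        simpa only [List.append_assoc] using
          ((List.perm_append_comm (l₁ := t.take m) (l₂ := vs)).append_right (t.drop m)).cons v
      _ = v :: vs ++ t := by rw [List.take_append_drop, List.cons_append]

theorem map_insertEvery (g : α → β) (m : ℕ) (vs t : List α) :
    (insertEvery m vs t).map g = insertEvery m (vs.map g) (t.map g) := by
  induction vs generalizing t with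
  | nil => simp [insertEvery]
  | cons v vs ih => simp [insertEvery, ih]

theorem insertEvery_append {vs t : List α} (h : t.length = m * vs.length) (ws u : List α) :
    insertEvery m (vs ++ ws) (t ++ u) = insertEvery m vs t ++ insertEvery m ws u := by
  induction vs generalizing t with
  | nil =>
    obtain rfl : t = [] := by simpa using h
    simp [insertEvery]
  | cons v vs ih =>
    rw [List.length_cons, Nat.mul_succ] at h
    rw [List.cons_append, insertEvery, insertEvery, List.take_append_of_le_length (by omega),
      List.drop_append_of_le_length (by omega), ih (by simp; omega)]
    simp

theorem take_insertEvery {vs t : List α} (h : m * vs.length ≤ t.length) :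
    (insertEvery m vs t).take m = t.take m := by
  cases vs with
  | nil => simp [insertEvery]
  | cons v vs =>
    rw [List.length_cons, Nat.mul_succ] at h
    have hlen : (t.take m).length = m := by simp; omega
    rw [insertEvery, List.take_append_of_le_length hlen.ge, List.take_take, min_self]

/- Two entries of `t` at distance `m + 1` always have an inserted entry between them, while two
entries of `vs` end up more than `m + 1` places apart and need not be related. -/
theorem IsPowerWalk.insertEvery {r : α → α → Prop} {vs t : List α}
    (hle : (m + 1) * vs.length ≤ t.length) (hlt : t.length ≤ (m + 1) * (vs.length + 1))
    (ht : IsPowerWalk r m t) (hv : ∀ v ∈ vs, ∀ a ∈ t, r v a ∧ r a v) :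
    IsPowerWalk r (m + 1) (insertEvery (m + 1) vs t) := by
  induction vs generalizing t with
  | nil => exact isPowerWalk_of_pairwise (ht.pairwise (by simpa using hlt))
  | cons v vs ih =>
    rw [List.length_cons, Nat.mul_succ] at hle hlt
    rw [Nat.mul_succ] at hlt
    have hdrop : (m + 1) * vs.length ≤ (t.drop (m + 1)).length := by simp; omega
    have hrest : IsPowerWalk r (m + 1) (PowerPath.insertEvery (m + 1) vs (t.drop (m + 1))) := by
      refine ih hdrop ?_ (ht.of_isInfix (List.drop_suffix _ t).isInfix) fun w hw a ha =>
        hv w (List.mem_cons_of_mem _ hw) a (List.mem_of_mem_drop ha)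
      rw [List.length_drop, Nat.mul_succ]
      omega
    refine IsPowerWalk.insert (Q := t.drop (m + 1)) (by simp) ?_ ?_ ?_ ?_
    · simpa [List.take_take] using congrArg (List.take m) (take_insertEvery hdrop)
    · rwa [List.take_append_drop]
    · rw [isPowerWalk_cons, take_insertEvery hdrop]
      exact ⟨fun b hb => (hv v List.mem_cons_self b
        (List.mem_of_mem_drop (List.mem_of_mem_take hb))).1, hrest⟩
    · exact fun a ha => (hv v List.mem_cons_self a (List.mem_of_mem_take ha)).2

end Insertion

section Counting

variable {A B : Type*}

theorem ncard_preimage_equiv (e : A ≃ B) (S : Set B) : (e ⁻¹' S).ncard = S.ncard :=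
  Set.ncard_preimage_of_injective_subset_range e.injective
    (e.surjective.range_eq ▸ Set.subset_univ S)

theorem ncard_eq_sum_fiber [Fintype A] [Finite B] (S : Set (A × B)) :
    S.ncard = ∑ a, {b | (a, b) ∈ S}.ncard := by
  have e : S ≃ Σ a, {b | (a, b) ∈ S} :=
    { toFun := fun x => ⟨x.1.1, x.1.2, x.2⟩
      invFun := fun y => ⟨(y.1, y.2.1), y.2.2⟩ }
  rw [← Nat.card_coe_set_eq, Nat.card_congr e, Nat.card_sigma]
  simp only [Nat.card_coe_set_eq]

theorem mul_le_ncard_of_fiber [Finite A] [Finite B] {S : Set (A × B)} {T : Set A} {c d : ℝ}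
    (hd : 0 ≤ d) (hT : c ≤ T.ncard) (hS : ∀ a ∈ T, d ≤ {b | (a, b) ∈ S}.ncard) :
    c * d ≤ S.ncard := by
  classical
  have := Fintype.ofFinite A
  calc c * d ≤ T.ncard * d := by gcongr
    _ = ∑ _ ∈ T.toFinset, d := by
      rw [Finset.sum_const, nsmul_eq_mul, Set.ncard_eq_toFinset_card']
    _ ≤ ∑ a ∈ T.toFinset, ({b | (a, b) ∈ S}.ncard : ℝ) :=
      Finset.sum_le_sum fun a ha => hS a (Set.mem_toFinset.1 ha)
    _ ≤ ∑ a, ({b | (a, b) ∈ S}.ncard : ℝ) :=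
      Finset.sum_le_sum_of_subset_of_nonneg (Finset.subset_univ _) fun _ _ _ => by positivity
    _ = S.ncard := by rw [ncard_eq_sum_fiber, Nat.cast_sum]

theorem le_ncard_rich_fiber [Fintype A] [Fintype B] [Nonempty B] {S : Set (A × B)} {c : ℝ}
    (hc : 0 ≤ c) (hS : c * Fintype.card A * Fintype.card B ≤ S.ncard) :
    c / 2 * Fintype.card A ≤
      {a | c / 2 * Fintype.card B ≤ ({b | (a, b) ∈ S}.ncard : ℝ)}.ncard := by
  classical
  set T := {a | c / 2 * Fintype.card B ≤ ({b | (a, b) ∈ S}.ncard : ℝ)} with hT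
  have hB : (0 : ℝ) < Fintype.card B := by exact_mod_cast Fintype.card_pos
  have hfiber : ∀ a, ({b | (a, b) ∈ S}.ncard : ℝ) ≤
      (if a ∈ T then (Fintype.card B : ℝ) else 0) + c / 2 * Fintype.card B := by
    intro a
    split_ifs with ha
    · have hle : ({b | (a, b) ∈ S}.ncard : ℝ) ≤ Fintype.card B := by
        exact_mod_cast Nat.card_eq_fintype_card (α := B) ▸ Set.ncard_le_card _
      linarith [mul_nonneg (half_pos hB).le hc]
    · rw [hT, Set.mem_ofPred_eq, not_le] at ha
      linarith
  have hsum : (S.ncard : ℝ) ≤ T.ncard * Fintype.card B +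
      Fintype.card A * (c / 2 * Fintype.card B) := by
    calc (S.ncard : ℝ) = ∑ a, ({b | (a, b) ∈ S}.ncard : ℝ) := by
          rw [ncard_eq_sum_fiber, Nat.cast_sum]
      _ ≤ ∑ a, ((if a ∈ T then (Fintype.card B : ℝ) else 0) + c / 2 * Fintype.card B) :=
          Finset.sum_le_sum fun a _ => hfiber a
      _ = _ := by
          rw [Finset.sum_add_distrib, ← Finset.sum_filter, Finset.sum_const, Finset.sum_const,
            nsmul_eq_mul, nsmul_eq_mul, Finset.card_univ, Set.filter_mem_univ_eq_toFinset,
            Set.ncard_eq_toFinset_card']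
  refine le_of_mul_le_mul_right ?_ hB
  linarith

theorem ncard_forall_mem (r : ℕ) (D : Set A) :
    {v : Fin r → A | ∀ i, v i ∈ D}.ncard = D.ncard ^ r := by
  have e : {v : Fin r → A | ∀ i, v i ∈ D} ≃ (Fin r → D) :=
    { toFun := fun v i => ⟨v.1 i, v.2 i⟩
      invFun := fun w => ⟨fun i => w i, fun i => (w i).2⟩ }
  rw [← Nat.card_coe_set_eq, Nat.card_congr e, Nat.card_fun, Nat.card_fin, Nat.card_coe_set_eq]

theorem le_ncard_pi_fiber [Fintype A] [Fintype B] {S : Set (A × B)} {c : ℝ} (hc : 0 ≤ c) (r : ℕ)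
    (hS : c * Fintype.card A * Fintype.card B ≤ S.ncard) :
    c ^ (r + 1) * (Fintype.card A : ℝ) ^ (r + 1) * Fintype.card B ≤
      {x : (Fin (r + 1) → A) × B | ∀ i, (x.1 i, x.2) ∈ S}.ncard := by
  let d : B → ℝ := fun b => {a | (a, b) ∈ S}.ncard
  have hsum : (S.ncard : ℝ) = ∑ b, d b := by
    rw [← ncard_preimage_equiv (Equiv.prodComm B A) S, ncard_eq_sum_fiber, Nat.cast_sum]
    rfl
  have hpow : ({x : (Fin (r + 1) → A) × B | ∀ i, (x.1 i, x.2) ∈ S}.ncard : ℝ) =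
      ∑ b, d b ^ (r + 1) := by
    rw [← ncard_preimage_equiv (Equiv.prodComm B (Fin (r + 1) → A)), ncard_eq_sum_fiber,
      Nat.cast_sum]
    refine Finset.sum_congr rfl fun b _ => ?_
    rw [← Nat.cast_pow]
    exact congrArg _ (ncard_forall_mem (r + 1) {a | (a, b) ∈ S})
  rcases isEmpty_or_nonempty B with hB | hB
  · simp [hpow]
  calc c ^ (r + 1) * (Fintype.card A : ℝ) ^ (r + 1) * Fintype.card B
    _ = (c * Fintype.card A * Fintype.card B) ^ (r + 1) / (Fintype.card B : ℝ) ^ r := by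
      rw [eq_div_iff (by positivity)]
      ring
    _ ≤ (∑ b, d b) ^ (r + 1) / (Fintype.card B : ℝ) ^ r := by
      rw [← hsum]
      gcongr
    _ ≤ ∑ b, d b ^ (r + 1) := by
      simpa using pow_sum_div_card_le_sum_pow (s := Finset.univ) (f := d)
        (fun b _ => Nat.cast_nonneg _) r
    _ = _ := hpow.symm

end Counting

section Functions

variable {V : Type*}

theorem le_ncard_greedy [Finite V] {β : ℝ} (hβ : 0 ≤ β) (P : List V → Prop) (N : ℕ) (hnil : P [])
    (hconcat : ∀ l, l.length < N → P l → β ≤ {a | P (l ++ [a])}.ncard) :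
    β ^ N ≤ {g : Fin N → V | P (List.ofFn g)}.ncard := by
  induction N with
  | zero =>
    have hall : {g : Fin 0 → V | P (List.ofFn g)} = Set.univ := by
      ext g
      simp [hnil]
    rw [hall, Set.ncard_univ]
    simp
  | succ N ih =>
    have hpairs := mul_le_ncard_of_fiber
      (S := {x : (Fin N → V) × V | P (List.ofFn x.1 ++ [x.2])}) hβ
      (ih fun l hl => hconcat l (by omega))
      (fun g hg => hconcat (List.ofFn g) (by rw [List.length_ofFn]; omega) hg)
    rw [pow_succ]
    refine hpairs.trans (Nat.cast_le.2 (Set.ncard_le_ncard_of_injOn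
      (fun x : (Fin N → V) × V => (Fin.snoc x.1 x.2 : Fin (N + 1) → V)) ?_ ?_))
    · intro x hx
      rw [Set.mem_ofPred_eq, List.ofFn_succ']
      simpa using hx
    · intro x _ y _ hxy
      exact Prod.ext (Fin.snoc_injective2 hxy).1 (Fin.snoc_injective2 hxy).2

theorem pow_succ_le_mul_descFactorial_add (n k : ℕ) :
    n ^ (k + 1) ≤ n * n.descFactorial k + k ^ 2 * n ^ k := by
  induction k with
  | zero => simp
  | succ k ih =>
    have hstep : n * n.descFactorial k ≤ n.descFactorial (k + 1) + k * n ^ k := by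
      calc n * n.descFactorial k ≤ (n - k + k) * n.descFactorial k := by gcongr; omega
        _ = n.descFactorial (k + 1) + k * n.descFactorial k := by
          rw [add_mul, Nat.descFactorial_succ]
        _ ≤ _ := by gcongr; exact Nat.descFactorial_le_pow n k
    calc n ^ (k + 1 + 1) = n * n ^ (k + 1) := pow_succ' _ _
      _ ≤ n * (n.descFactorial (k + 1) + k * n ^ k + k ^ 2 * n ^ k) := by gcongr; omega
      _ = n * n.descFactorial (k + 1) + (k + k ^ 2) * n ^ (k + 1) := by ring
      _ ≤ _ := by gcongr; nlinarith

variable {ι : Type*}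

theorem ncard_injective [Fintype V] [Fintype ι] :
    {f : ι → V | Function.Injective f}.ncard = (Fintype.card V).descFactorial (Fintype.card ι) := by
  classical
  rw [← Fintype.card_embedding_eq, ← Nat.card_eq_fintype_card, ← Nat.card_coe_set_eq]
  exact Nat.card_congr (Equiv.subtypeInjectiveEquivEmbedding ι V)

theorem le_ncard_injective [Fintype V] [Nonempty V] [Fintype ι] {F : Set (ι → V)} {c : ℝ}
    (hn : 2 * (Fintype.card ι : ℝ) ^ 2 ≤ c * Fintype.card V)
    (hF : c * (Fintype.card V : ℝ) ^ Fintype.card ι ≤ F.ncard) :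
    c / 2 * (Fintype.card V : ℝ) ^ Fintype.card ι ≤ {f ∈ F | Function.Injective f}.ncard := by
  set n := Fintype.card V
  set k := Fintype.card ι
  have hn₀ : (0 : ℝ) < n := by exact_mod_cast Fintype.card_pos
  have hunion : F.ncard + n.descFactorial k ≤ {f ∈ F | Function.Injective f}.ncard + n ^ k := by
    have hinter := Set.ncard_union_add_ncard_inter F {f : ι → V | Function.Injective f}
    have huniv : (F ∪ {f : ι → V | Function.Injective f}).ncard ≤ n ^ k := by
      simpa [n, k, Nat.card_fun, Nat.card_eq_fintype_card] using Set.ncard_le_card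
        (F ∪ {f : ι → V | Function.Injective f})
    rw [show _ = n.descFactorial k from ncard_injective] at hinter
    change _ ≤ (F ∩ {f : ι → V | Function.Injective f}).ncard + _
    omega
  have hpow := pow_succ_le_mul_descFactorial_add n k
  rw [pow_succ'] at hpow
  have hmul : c / 2 * (n : ℝ) ^ k * n ≤ {f ∈ F | Function.Injective f}.ncard * n := by
    have hunion' : (F.ncard : ℝ) + n.descFactorial k ≤
        {f ∈ F | Function.Injective f}.ncard + (n : ℝ) ^ k := by exact_mod_cast hunion
    have hpow' : (n : ℝ) * (n : ℝ) ^ k ≤ n * n.descFactorial k + (k : ℝ) ^ 2 * (n : ℝ) ^ k := by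
      exact_mod_cast hpow
    have hnk := mul_le_mul_of_nonneg_right hn (pow_nonneg hn₀.le k)
    have hmulF := mul_le_mul_of_nonneg_left (add_le_add hF hunion') hn₀.le
    linarith
  exact le_of_mul_le_mul_right hmul hn₀

/-- Exchange the values of `f` at `i` and `j` with the pair `a`. -/
def exchange [DecidableEq ι] (i j : ι) (x : (V × V) × (ι → V)) : (V × V) × (ι → V) :=
  ((x.2 i, x.2 j), Function.update (Function.update x.2 i x.1.1) j x.1.2)

theorem exchange_involutive [DecidableEq ι] {i j : ι} (hij : i ≠ j) :
    Function.Involutive (exchange i j : (V × V) × (ι → V) → _) := by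
  rintro ⟨⟨a, b⟩, f⟩
  simp only [exchange, Function.update_self, Function.update_of_ne hij]
  simp [Function.update_comm hij]

theorem ncard_exchange_mem [Fintype V] [DecidableEq ι] {i j : ι} (hij : i ≠ j) (F : Set (ι → V)) :
    {x : (V × V) × (ι → V) | (exchange i j x).2 ∈ F}.ncard = Fintype.card V ^ 2 * F.ncard := by
  have hpre := ncard_preimage_equiv (exchange_involutive hij).toPerm
    ((Set.univ : Set (V × V)) ×ˢ F)
  rw [Set.ncard_prod, Set.ncard_univ, Nat.card_prod, Nat.card_eq_fintype_card, ← sq] at hpre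
  rw [← hpre]
  congr 1
  ext x
  simp

end Functions

section Matchings

variable {ι κ : Type*}

/-- The entries of the pairs in a list, with multiplicity. -/
def endpoints (M : List (ι × ι)) : List ι := M.flatMap fun e => [e.1, e.2]

/-- The pairs in the list are pairwise disjoint two-element sets. -/
def IsMatching (M : List (ι × ι)) : Prop := (endpoints M).Nodup

theorem endpoints_append (M N : List (ι × ι)) : endpoints (M ++ N) = endpoints M ++ endpoints N :=
  List.flatMap_append

theorem endpoints_map (g : ι → κ) (M : List (ι × ι)) :
    endpoints (M.map (Prod.map g g)) = (endpoints M).map g := by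
  simp [endpoints, List.flatMap_map, List.map_flatMap]

/-- The union of two lists of pairs over disjoint label sets. -/
def sumMatching (M : List (ι × ι)) (N : List (κ × κ)) : List ((ι ⊕ κ) × (ι ⊕ κ)) :=
  M.map (Prod.map Sum.inl Sum.inl) ++ N.map (Prod.map Sum.inr Sum.inr)

theorem IsMatching.sum {M : List (ι × ι)} {N : List (κ × κ)} (hM : IsMatching M)
    (hN : IsMatching N) : IsMatching (sumMatching M N) := by
  rw [IsMatching, sumMatching, endpoints_append, endpoints_map, endpoints_map]
  refine (hM.map Sum.inl_injective).append (hN.map Sum.inr_injective) fun a ha hb => ?_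
  obtain ⟨i, -, rfl⟩ := List.mem_map.1 ha
  obtain ⟨k, -, hk⟩ := List.mem_map.1 hb
  exact Sum.inr_ne_inl hk

/-- The pairs joining the entries of `g` to new labels. -/
def crossMatching {m : ℕ} (g : Fin m → ι) : List ((ι ⊕ Fin m) × (ι ⊕ Fin m)) :=
  List.ofFn fun s => (Sum.inl (g s), Sum.inr s)

theorem isMatching_crossMatching {m : ℕ} {g : Fin m → ι} (hg : g.Injective) :
    IsMatching (crossMatching g) := by
  rw [IsMatching, endpoints, List.nodup_flatMap, crossMatching, List.pairwise_ofFn]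
  refine ⟨fun e he => ?_, fun s t hst => ?_⟩
  · obtain ⟨s, rfl⟩ := (List.mem_ofFn' _ _).1 he
    simp
  · simp [Function.onFun, List.Disjoint, hg.eq_iff, hst.ne]

end Matchings

section Connections

variable {V : Type*} {G : SimpleGraph V} {X Y : Set V}

/-- Any at most `m` vertices of `Y` have at least `β` common neighbours in `X`. -/
def HasCommonNbrs (G : SimpleGraph V) (X Y : Set V) (m : ℕ) (β : ℝ) : Prop :=
  ∀ l : List V, l.length ≤ m → (∀ a ∈ l, a ∈ Y) → β ≤ {w | w ∈ X ∧ ∀ a ∈ l, G.Adj a w}.ncard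

theorem HasCommonNbrs.inter_neighborSet {m : ℕ} {β : ℝ} {v : V}
    (hG : HasCommonNbrs G X Y (m + 1) β) (hv : v ∈ Y) :
    HasCommonNbrs G (X ∩ G.neighborSet v) Y m β := by
  intro l hl hlY
  refine (hG (v :: l) (by simpa using hl) (by simpa using ⟨hv, hlY⟩)).trans_eq ?_
  congr 2
  ext w
  simp [and_assoc]

theorem le_ncard_walk_extensions [Finite V] {m N : ℕ} {β : ℝ} {x c : List V} (hβ : 0 ≤ β)
    (hXY : X ⊆ Y) (hG : HasCommonNbrs G X Y (m + c.length) β) (hx : ∀ a ∈ x, a ∈ Y)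
    (hc : ∀ a ∈ c, a ∈ Y) :
    β ^ N ≤ {g : Fin N → V | (∀ i, g i ∈ X ∧ ∀ v ∈ c, G.Adj v (g i)) ∧
      ∀ F, G ≤ F → IsPowerWalk F.Adj m x → IsPowerWalk F.Adj m (x ++ List.ofFn g)}.ncard := by
  have hgreedy := le_ncard_greedy hβ (fun l => (∀ a ∈ l, a ∈ X ∧ ∀ v ∈ c, G.Adj v a) ∧
    ∀ F, G ≤ F → IsPowerWalk F.Adj m x → IsPowerWalk F.Adj m (x ++ l)) N (by simp) ?_
  · simpa [List.forall_mem_ofFn_iff] using hgreedy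
  rintro l - ⟨hlX, hl⟩
  have hnbrs := hG ((x ++ l).drop ((x ++ l).length - m) ++ c) (by simp; omega) fun a ha => by
    rcases List.mem_append.1 ha with ha | ha
    · rcases List.mem_append.1 (List.mem_of_mem_drop ha) with ha | ha
      exacts [hx a ha, hXY (hlX a ha).1]
    · exact hc a ha
  refine hnbrs.trans (Nat.cast_le.2 (Set.ncard_le_ncard ?_))
  rintro w ⟨hwX, hw⟩
  refine ⟨fun a ha => ?_, fun F hF hwalk => ?_⟩
  · rcases List.mem_append.1 ha with ha | ha
    · exact hlX a ha
    · rw [List.mem_singleton.1 ha]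
      exact ⟨hwX, fun v hv => hw v (List.mem_append_right _ hv)⟩
  · rw [← List.append_assoc]
    exact (hl F hF hwalk).concat fun b hb => hF (hw b (List.mem_append_left _ hb))

variable {ι : Type*}

/-- The choices of vertices of `X` for the labels in `ι` such that, in every graph containing `G`
in which `x` and `z` are cliques and the pairs of `M` are adjacent, the pattern `π` connects `x` to
`z` by an `m`-walk. -/
def connections (G : SimpleGraph V) (M : List (ι × ι)) (m : ℕ) (X : Set V) (π : List ι)
    (x z : List V) : Set (ι → V) :=
  {f | (∀ i, f i ∈ X) ∧ ∀ F, G ≤ F → (∀ e ∈ M, F.Adj (f e.1) (f e.2)) → x.Pairwise F.Adj →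
    z.Pairwise F.Adj → IsPowerWalk F.Adj m (x ++ π.map f ++ z)}

/-- The pattern `π`, with pairs `M`, connects any two `m`-tuples in a graph on `V` by at least
`c |V| ^ |ι|` choices of vertices, provided that any `m` vertices have `α |V|` common neighbours. -/
def HasManyConnections (V : Type*) [Fintype V] [Fintype ι] (m : ℕ) (π : List ι) (M : List (ι × ι))
    (α c : ℝ) : Prop :=
  ∀ (G : SimpleGraph V) (X Y : Set V), X ⊆ Y →
    HasCommonNbrs G X Y m (α * Fintype.card V) →
    ∀ x z : List V, x.length = m → z.length = m → (∀ a ∈ x, a ∈ Y) → (∀ a ∈ z, a ∈ Y) →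
      c * (Fintype.card V : ℝ) ^ Fintype.card ι ≤ (connections G M m X π x z).ncard

theorem hasManyConnections_bool [Fintype V] {α : ℝ} (hα : 0 ≤ α) :
    HasManyConnections V 1 [false, true] [(false, true)] α (α * α) := by
  intro G X Y _ hG x z hx hz hxY hzY
  obtain ⟨x, rfl⟩ := List.length_eq_one_iff.1 hx
  obtain ⟨z, rfl⟩ := List.length_eq_one_iff.1 hz
  have hpairs := mul_le_ncard_of_fiber
    (S := {w | w ∈ X ∧ ∀ a ∈ [x], G.Adj a w} ×ˢ {w | w ∈ X ∧ ∀ a ∈ [z], G.Adj a w})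
    (by positivity) (hG [x] le_rfl hxY)
    (fun a ha => (hG [z] le_rfl hzY).trans_eq (by simp [ha.1, ha.2 x (by simp)]))
  refine le_trans (by simp; linarith) (hpairs.trans (Nat.cast_le.2
    ((ncard_preimage_equiv (Equiv.boolArrowEquivProd V) _).symm.trans_le
      (Set.ncard_le_ncard ?_))))
  rintro f ⟨⟨hfX, hxf⟩, hfX', hzf⟩
  refine ⟨Bool.forall_bool.2 ⟨hfX, hfX'⟩, fun F hF hM _ _ => ?_⟩
  have hMf : F.Adj (f false) (f true) := hM (false, true) (by simp)
  have hxf : F.Adj x (f false) := hF (hxf x (by simp))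
  have hzf : F.Adj (f true) z := hF (hzf z (by simp)).symm
  simp [isPowerWalk_cons, isPowerWalk_nil, hMf, hxf, hzf]

end Connections

section Leads

variable {V : Type*} {G : SimpleGraph V} {X Y : Set V} {m e : ℕ} {x : List V}

/-- The choices of a *lead* of `x` into the neighbourhood of the hub `v`: a head of `e + (m + 1)`
vertices followed by a tail of `m + 1` neighbours of `v`, all in `X`. In every graph containing `G`
in which `x` is a clique and the last `m + 1` head vertices are adjacent to the corresponding tail
vertices, `x` followed by the head and the tail is an `(m + 1)`-walk. -/
def leads (G : SimpleGraph V) (m e : ℕ) (X : Set V) (x : List V) (v : V) :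
    Set (Fin (e + (m + 1)) ⊕ Fin (m + 1) → V) :=
  {h | (∀ s, h s ∈ X) ∧ (∀ s, G.Adj v (h (Sum.inr s))) ∧ ∀ F, G ≤ F → x.Pairwise F.Adj →
    (∀ s, F.Adj (h (Sum.inl (Fin.natAdd e s))) (h (Sum.inr s))) →
    IsPowerWalk F.Adj (m + 1)
      (x ++ List.ofFn (h ∘ Sum.inl) ++ List.ofFn (h ∘ Sum.inr))}

theorem mem_leads_of_extensions {v : V} {h : Fin (e + (m + 1)) ⊕ Fin (m + 1) → V}
    (hX : ∀ s, h s ∈ X) (hv : ∀ s, G.Adj v (h (Sum.inr s)))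
    (hhead : ∀ F, G ≤ F → IsPowerWalk F.Adj (m + 1) x →
      IsPowerWalk F.Adj (m + 1) (x ++ List.ofFn (h ∘ Sum.inl)))
    (htail : ∀ F, G ≤ F → IsPowerWalk F.Adj m (x ++ List.ofFn (h ∘ Sum.inl)) →
      IsPowerWalk F.Adj m (x ++ List.ofFn (h ∘ Sum.inl) ++ List.ofFn (h ∘ Sum.inr))) :
    h ∈ leads G m e X x v := by
  refine ⟨hX, hv, fun F hF hx hadj => ?_⟩
  have hP := hhead F hF (isPowerWalk_of_pairwise hx)
  have hPQ := htail F hF (hP.mono_exponent (Nat.le_succ m))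
  rw [List.ofFn_add, ← List.append_assoc] at hP hPQ ⊢
  refine hP.append_of_forall₂ hPQ (List.length_ofFn ..) (List.forall₂_iff_get.2 ⟨by simp, ?_⟩)
  intro i hi _
  simpa only [List.get_eq_getElem, List.getElem_ofFn, Function.comp_apply] using
    hadj ⟨i, by rwa [List.length_ofFn] at hi⟩

theorem le_ncard_leads [Finite V] {β : ℝ} {v : V} (e : ℕ) (hβ : 0 ≤ β) (hXY : X ⊆ Y)
    (hG : HasCommonNbrs G X Y (m + 1) β) (hx : ∀ a ∈ x, a ∈ Y) (hv : v ∈ Y) :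
    β ^ (e + (m + 1)) * β ^ (m + 1) ≤ (leads G m e X x v).ncard := by
  rw [← ncard_preimage_equiv (Equiv.sumArrowEquivProdArrow _ _ V).symm]
  refine mul_le_ncard_of_fiber (by positivity) (le_ncard_walk_extensions (m := m + 1) (c := [])
    (x := x) hβ hXY hG hx (by simp)) ?_
  rintro P ⟨hPX, hP⟩
  refine (le_ncard_walk_extensions (m := m) (c := [v]) (x := x ++ List.ofFn P) hβ hXY hG ?_
    (by simpa using hv)).trans (Nat.cast_le.2 (Set.ncard_le_ncard ?_))
  · intro a ha
    rcases List.mem_append.1 ha with ha | ha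
    · exact hx a ha
    · obtain ⟨s, rfl⟩ := (List.mem_ofFn' _ _).1 ha
      exact hXY (hPX s).1
  · rintro Q ⟨hQX, hQ⟩
    refine mem_leads_of_extensions ?_ (fun s => (hQX s).2 v (by simp)) hP hQ
    rintro (s | s)
    exacts [(hPX s).1, (hQX s).1]

end Leads

section Hubs

variable {α : Type*} {r : α → α → Prop} {m : ℕ}

theorem exists_insertEvery_eq {A C vs : List α} (hm : m ≠ 0) (hA : A.length = m)
    (hlen : (A ++ C).length = m * vs.length) (B : List α) :
    ∃ S, insertEvery m vs (A ++ C ++ B) = A ++ S ++ B := by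
  obtain ⟨v, vs, rfl⟩ := List.exists_cons_of_ne_nil (l := vs) (by
    rintro rfl
    simp at hlen
    simp [hlen.1] at hA
    omega)
  have hC : C.length = m * vs.length := by
    rw [List.length_append, hA, List.length_cons, Nat.mul_succ] at hlen
    omega
  have happ := insertEvery_append hC [] B
  refine ⟨v :: insertEvery m vs C, ?_⟩
  rw [List.append_nil] at happ
  simp [insertEvery, List.take_left' hA, List.drop_left' hA, happ]

theorem IsPowerWalk.glue_core {Q C Q' : List α} {a b : α} (hQ : IsPowerWalk r m (a :: Q))
    (hQ' : IsPowerWalk r m (Q' ++ [b])) (hm : m ≤ Q.length) (hm' : m ≤ Q'.length)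
    (hC : IsPowerWalk r m (Q ++ C ++ Q')) : IsPowerWalk r m (a :: Q ++ C ++ (Q' ++ [b])) := by
  rw [List.append_assoc] at hC
  have hleft : IsPowerWalk r m ([a] ++ Q ++ (C ++ Q')) := append_of_overlap hQ hC hm
  rw [← List.append_assoc] at hleft
  simpa using append_of_overlap hleft hQ' hm'

theorem IsPowerWalk.insert_hubs {x P Q C Q' P' z hubs : List α} {a b : α}
    (hl : IsPowerWalk r (m + 1) (x ++ P ++ a :: Q))
    (hr : IsPowerWalk r (m + 1) (Q' ++ [b] ++ (P' ++ z)))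
    (hQ : Q.length = m) (hQ' : Q'.length = m)
    (hC : Q.Pairwise r → Q'.Pairwise r → IsPowerWalk r m (Q ++ C ++ Q'))
    (hlen : (a :: Q ++ C).length = (m + 1) * hubs.length)
    (hhubs : ∀ v ∈ hubs, ∀ w ∈ a :: Q ++ C ++ (Q' ++ [b]), r v w ∧ r w v) :
    IsPowerWalk r (m + 1) (x ++
      (P ++ PowerPath.insertEvery (m + 1) hubs (a :: Q ++ C ++ (Q' ++ [b])) ++ P') ++ z) := by
  have haQ := hl.of_isInfix (List.suffix_append _ _).isInfix
  have hQb := hr.of_isInfix (List.prefix_append _ _).isInfix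
  have hcore : IsPowerWalk r m (a :: Q ++ C ++ (Q' ++ [b])) :=
    glue_core (haQ.mono_exponent (Nat.le_succ m)) (hQb.mono_exponent (Nat.le_succ m)) hQ.ge hQ'.ge
      (hC (haQ.pairwise (by simp [hQ])).of_cons
        (List.pairwise_append.1 (hQb.pairwise (by simp [hQ']))).1)
  have hlen' : (a :: Q ++ C ++ (Q' ++ [b])).length = (m + 1) * (hubs.length + 1) := by
    rw [List.length_append, hlen, Nat.mul_succ]
    simp [hQ']
  have hmiddle := IsPowerWalk.insertEvery (hlen'.symm ▸ Nat.mul_le_mul_left _ (Nat.le_succ _))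
    hlen'.le hcore hhubs
  obtain ⟨S, hS⟩ := exists_insertEvery_eq (Nat.succ_ne_zero m) (by simp [hQ]) hlen (Q' ++ [b])
  rw [hS, List.append_assoc] at hmiddle
  rw [hS]
  have hleft := append_of_overlap hl hmiddle (by simp [hQ])
  rw [← List.append_assoc] at hleft
  simpa using append_of_overlap hleft hr (by simp [hQ'])

end Hubs

section Step

variable {V ι : Type*} {i q : ℕ}

/-- The labels of the pattern connecting `(i + 2)`-tuples: the copies of the hub, the two leads, and
the labels of a pattern connecting `(i + 1)`-tuples inside the neighbourhood of the hub. -/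
abbrev StepLabel (ι : Type*) (i q : ℕ) : Type _ :=
  Fin (q + 1) ⊕ (Fin (1 + (i + 2)) ⊕ Fin (i + 2)) ⊕ (Fin (2 + (i + 2)) ⊕ Fin (i + 2)) ⊕ ι

/-- The label of a copy of the hub. -/
def hub (s : Fin (q + 1)) : StepLabel ι i q := Sum.inl s

/-- The labels of the lead of the left end into the neighbourhood of the hub. -/
def leftLead (s : Fin (1 + (i + 2)) ⊕ Fin (i + 2)) : StepLabel ι i q := Sum.inr (Sum.inl s)

/-- The labels of the lead of the reversed right end into the neighbourhood of the hub. Its head is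
one longer than that of the left lead, so that the length of the pattern is a multiple of
`i + 3`. -/
def rightLead (s : Fin (2 + (i + 2)) ⊕ Fin (i + 2)) : StepLabel ι i q :=
  Sum.inr (Sum.inr (Sum.inl s))

/-- The labels of the pattern inside the neighbourhood of the hub. -/
def core (a : ι) : StepLabel ι i q := Sum.inr (Sum.inr (Sum.inr a))

/-- The pattern connecting `(i + 2)`-tuples built from a pattern `π` connecting `(i + 1)`-tuples. -/
def stepPattern (i q : ℕ) (π : List ι) : List (StepLabel ι i q) :=
  List.ofFn (leftLead ∘ Sum.inl) ++
    insertEvery (i + 2) (List.ofFn hub) (List.ofFn (leftLead ∘ Sum.inr) ++ π.map core ++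
      (List.ofFn (rightLead ∘ Sum.inr)).reverse) ++
    (List.ofFn (rightLead ∘ Sum.inl)).reverse

/-- The pairs of the pattern `stepPattern i q π`. -/
def stepMatching (i q : ℕ) (M : List (ι × ι)) : List (StepLabel ι i q × StepLabel ι i q) :=
  sumMatching [] (sumMatching (crossMatching (Fin.natAdd 1))
    (sumMatching (crossMatching (Fin.natAdd 2)) M))

theorem isMatching_stepMatching {M : List (ι × ι)} (hM : IsMatching M) :
    IsMatching (stepMatching i q M) :=
  .sum List.nodup_nil (.sum (isMatching_crossMatching (Fin.natAdd_injective _ _))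
    (.sum (isMatching_crossMatching (Fin.natAdd_injective _ _)) hM))

theorem length_stepPattern {π : List ι} (hπ : π.length = (i + 2) * q) :
    (stepPattern i q π).length = (i + 3) * (q + 4) := by
  simp [stepPattern, (insertEvery_perm _ _ _).length_eq, hπ]
  ring

theorem nodup_stepPattern {π : List ι} (hπ : π.Nodup) : (stepPattern i q π).Nodup := by
  rw [stepPattern, (((insertEvery_perm _ _ _).append_left _).append_right _).nodup_iff]
  have hι := hπ.map (f := core (i := i) (q := q)) fun _ _ h => by simpa [core] using h
  simp only [List.nodup_append, List.nodup_reverse, List.nodup_ofFn, hι]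
  simp [Function.Injective, hub, leftLead, rightLead, core, List.mem_ofFn']

variable {V : Type*} {G : SimpleGraph V} {X Y : Set V} {M : List (ι × ι)} {π : List ι}
  {x z : List V}

theorem map_stepPattern (f : StepLabel ι i q → V) :
    (stepPattern i q π).map f = List.ofFn (f ∘ leftLead ∘ Sum.inl) ++
      insertEvery (i + 2) (List.ofFn (f ∘ hub)) (List.ofFn (f ∘ leftLead ∘ Sum.inr) ++
        π.map (f ∘ core) ++ (List.ofFn (f ∘ rightLead ∘ Sum.inr)).reverse) ++
      (List.ofFn (f ∘ rightLead ∘ Sum.inl)).reverse := by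
  simp only [stepPattern, List.map_append, map_insertEvery, List.map_reverse, List.map_ofFn,
    List.map_map]

theorem mem_connections_stepPattern {f : StepLabel ι i q → V} (hπ : π.length = (i + 2) * q)
    (hhub : ∀ s, f (hub s) ∈ X)
    (hleft : ∀ s, f ∘ leftLead ∈ leads G (i + 1) 1 X x (f (hub s)))
    (hright : ∀ s, f ∘ rightLead ∈ leads G (i + 1) 2 X z.reverse (f (hub s)))
    (hcore : ∀ s, f ∘ core ∈ connections G M (i + 1) (X ∩ G.neighborSet (f (hub s))) π
      (List.ofFn fun t : Fin (i + 1) => f (leftLead (Sum.inr t.succ)))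
      (List.ofFn fun t : Fin (i + 1) => f (rightLead (Sum.inr t.succ))).reverse) :
    f ∈ connections G (stepMatching i q M) (i + 2) X (stepPattern i q π) x z := by
  refine ⟨?_, fun F hF hM hx hz => ?_⟩
  · rintro (s | s | s | a)
    exacts [hhub s, (hleft 0).1 s, (hright 0).1 s, ((hcore 0).1 a).1]
  simp only [stepMatching, sumMatching, crossMatching, List.map_nil, List.nil_append,
    List.forall_mem_append, List.forall_mem_map, List.forall_mem_ofFn_iff] at hM
  obtain ⟨hMleft, hMright, hMcore⟩ := hM
  have hl := (hleft 0).2.2 F hF hx hMleft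
  have hr := ((hright 0).2.2 F hF (List.pairwise_reverse.2 (hz.imp F.adj_symm)) hMright).reverse
    fun _ _ => F.adj_symm
  have hadj : ∀ v ∈ List.ofFn (f ∘ hub), ∀ w ∈ List.ofFn (f ∘ leftLead ∘ Sum.inr) ++
      π.map (f ∘ core) ++ (List.ofFn (f ∘ rightLead ∘ Sum.inr)).reverse, F.Adj v w := by
    simp only [List.forall_mem_ofFn_iff, List.forall_mem_append, List.mem_reverse,
      List.forall_mem_map]
    exact fun s => ⟨⟨fun t => hF ((hleft s).2.1 t), fun a _ => hF ((hcore s).1 a).2⟩,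
      fun t => hF ((hright s).2.1 t)⟩
  rw [List.ofFn_succ (f := (f ∘ leftLead) ∘ Sum.inr)] at hl
  rw [List.ofFn_succ (f := (f ∘ rightLead) ∘ Sum.inr), List.reverse_append, List.reverse_append,
    List.reverse_reverse, List.reverse_cons] at hr
  rw [List.ofFn_succ (f := f ∘ leftLead ∘ Sum.inr), List.ofFn_succ (f := f ∘ rightLead ∘ Sum.inr),
    List.reverse_cons] at hadj
  rw [map_stepPattern, List.ofFn_succ (f := f ∘ leftLead ∘ Sum.inr),
    List.ofFn_succ (f := f ∘ rightLead ∘ Sum.inr), List.reverse_cons]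
  exact IsPowerWalk.insert_hubs hl hr (by simp) (by simp) ((hcore 0).2 F hF hMcore)
    (by simp [hπ]; ring) fun v hv w hw => ⟨hadj v hv w hw, (hadj v hv w hw).symm⟩

end Step

section StepCount

variable {V ι : Type*} {G : SimpleGraph V} {X Y : Set V} {i q : ℕ} {M : List (ι × ι)} {π : List ι}
  {x z : List V} {α c : ℝ}

/-- The choices of the left lead, the right lead and the core that fit the hub `v`. -/
def hubCompletions (G : SimpleGraph V) (M : List (ι × ι)) (i : ℕ) (X : Set V) (π : List ι)
    (x z : List V) (v : V) :
    Set ((Fin (1 + (i + 2)) ⊕ Fin (i + 2) → V) × (Fin (2 + (i + 2)) ⊕ Fin (i + 2) → V) ×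
      (ι → V)) :=
  {h | h.1 ∈ leads G (i + 1) 1 X x v ∧ h.2.1 ∈ leads G (i + 1) 2 X z.reverse v ∧
    h.2.2 ∈ connections G M (i + 1) (X ∩ G.neighborSet v) π
      (List.ofFn fun t : Fin (i + 1) => h.1 (Sum.inr t.succ))
      (List.ofFn fun t : Fin (i + 1) => h.2.1 (Sum.inr t.succ)).reverse}

theorem le_ncard_hubCompletions [Fintype V] [Fintype ι] {v : V} (hα : 0 ≤ α)
    (hc : 0 ≤ c) (hπ : HasManyConnections V (i + 1) π M α c) (hXY : X ⊆ Y)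
    (hG : HasCommonNbrs G X Y (i + 2) (α * Fintype.card V)) (hx : ∀ a ∈ x, a ∈ Y)
    (hz : ∀ a ∈ z, a ∈ Y) (hv : v ∈ Y) :
    (α * Fintype.card V) ^ (1 + (i + 2)) * (α * Fintype.card V) ^ (i + 2) *
      ((α * Fintype.card V) ^ (2 + (i + 2)) * (α * Fintype.card V) ^ (i + 2) *
        (c * (Fintype.card V : ℝ) ^ Fintype.card ι)) ≤ (hubCompletions G M i X π x z v).ncard := by
  have hleads := fun e y hy => le_ncard_leads (x := y) e (by positivity) hXY hG hy hv
  refine mul_le_ncard_of_fiber (by positivity) (hleads 1 x hx) fun L hL => ?_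
  refine (mul_le_ncard_of_fiber (by positivity) (hleads 2 z.reverse (by simpa using hz))
    fun R hR => ?_).trans (Nat.cast_le.2 (Set.ncard_le_ncard fun h hh => And.intro hL hh))
  refine (hπ G _ Y (Set.inter_subset_left.trans hXY) (hG.inter_neighborSet hv)
    (List.ofFn fun t : Fin (i + 1) => L (Sum.inr t.succ))
    (List.ofFn fun t : Fin (i + 1) => R (Sum.inr t.succ)).reverse (by simp) (by simp) ?_ ?_).trans
      (Nat.cast_le.2 (Set.ncard_le_ncard fun g hg => And.intro hR hg))
  · exact List.forall_mem_ofFn_iff.2 fun t => hXY (hL.1 _)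
  · simp only [List.mem_reverse]
    exact List.forall_mem_ofFn_iff.2 fun t => hXY (hR.1 _)

/-- The constant in the count of connections by `stepPattern`: the hub, the heads and tails of the
leads, and the core contribute the factors `α`, powers of `α`, and `c`. -/
def stepConst (i : ℕ) (α c : ℝ) : ℝ :=
  α * (α ^ (1 + (i + 2)) * α ^ (i + 2) * (α ^ (2 + (i + 2)) * α ^ (i + 2) * c))

theorem hasManyConnections_stepPattern [Fintype V] [Fintype ι] (hα : 0 ≤ α) (hc : 0 ≤ c)
    (hlen : π.length = (i + 2) * q) (hπ : HasManyConnections V (i + 1) π M α c) :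
    HasManyConnections V (i + 2) (stepPattern i q π) (stepMatching i q M) α
      (stepConst i α c ^ (q + 1)) := by
  classical
  intro G X Y hXY hG x z _ _ hxY hzY
  let e : (StepLabel ι i q → V) ≃ (Fin (q + 1) → V) × (Fin (1 + (i + 2)) ⊕ Fin (i + 2) → V) ×
      (Fin (2 + (i + 2)) ⊕ Fin (i + 2) → V) × (ι → V) :=
    (Equiv.sumArrowEquivProdArrow _ _ V).trans (.prodCongr (.refl _)
      ((Equiv.sumArrowEquivProdArrow _ _ V).trans (.prodCongr (.refl _)
        (Equiv.sumArrowEquivProdArrow _ _ V))))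
  have hhubs := mul_le_ncard_of_fiber (S := {h | h.1 ∈ X ∧ h.2 ∈ hubCompletions G M i X π x z h.1})
    (by positivity) (hG [] (by simp) (by simp)) fun v hv =>
    (le_ncard_hubCompletions hα hc hπ hXY hG hxY hzY (hXY hv.1)).trans
      (Nat.cast_le.2 (Set.ncard_le_ncard fun h hh => And.intro hv.1 hh))
  have hpi := le_ncard_pi_fiber (c := stepConst i α c) (by unfold stepConst; positivity) q
    (le_trans (le_of_eq ?_) hhubs)
  · rw [← ncard_preimage_equiv e] at hpi
    refine (le_of_eq ?_).trans (hpi.trans (Nat.cast_le.2 (Set.ncard_le_ncard fun f hf => ?_)))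
    · simp [StepLabel]
      ring
    · exact mem_connections_stepPattern hlen (fun s => (hf s).1) (fun s => (hf s).2.1)
        (fun s => (hf s).2.2.1) fun s => (hf s).2.2.2
  · simp [stepConst]
    ring

theorem exists_connecting_pattern (j : ℕ) :
    ∃ (ι : Type) (_ : Fintype ι) (π : List ι) (M : List (ι × ι)) (q : ℕ),
      π.Nodup ∧ IsMatching M ∧ π.length = (j + 2) * q ∧
      ∀ α : ℝ, 0 < α → ∃ c > 0, ∀ (V : Type*) [Fintype V],
        HasManyConnections V (j + 1) π M α c := by
  induction j with
  | zero =>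
    exact ⟨Bool, inferInstance, [false, true], [(false, true)], 1, by simp,
      by simp [IsMatching, endpoints], by simp, fun α hα =>
        ⟨α * α, by positivity, fun V _ => hasManyConnections_bool hα.le⟩⟩
  | succ j ih =>
    obtain ⟨ι, _, π, M, q, hπ, hM, hlen, hcount⟩ := ih
    refine ⟨StepLabel ι j q, inferInstance, stepPattern j q π, stepMatching j q M, q + 4,
      nodup_stepPattern hπ, isMatching_stepMatching hM, length_stepPattern hlen, fun α hα => ?_⟩
    obtain ⟨c, hc, hcount⟩ := hcount α hα
    exact ⟨stepConst j α c ^ (q + 1), by unfold stepConst; positivity, fun V _ =>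
      hasManyConnections_stepPattern hα.le hc.le hlen (hcount V)⟩

end StepCount

section RandomGraphs

open MeasureTheory ProbabilityTheory unitInterval
open scoped ENNReal

section AvoidedEdges

theorem setBernoulli_forall_notMem {A : Type*} {u : Set A} (p : I) (S : Finset A)
    (hS : ∀ a ∈ S, a ∈ u) :
    setBernoulli u p {s | ∀ a ∈ S, a ∉ s} = (toNNReal (σ p) : ℝ≥0∞) ^ S.card := by
  have hpre : (fun q : A → Prop => {a | q a}) ⁻¹' {s | ∀ a ∈ S, a ∉ s} =
      Set.pi S fun _ => {False} := by
    ext q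
    simp [Set.mem_pi]
  rw [setBernoulli_apply', hpre, Measure.infinitePi_pi _ fun _ _ => MeasurableSet.of_discrete]
  refine Finset.prod_eq_pow_card fun a ha => ?_
  simp [hS a ha]

variable {V : Type*}

theorem binomialRandom_forall_notMem_edgeSet_le [Countable V] (p : I) (S : Finset (Sym2 V))
    (hS : ∀ e ∈ S, ¬ e.IsDiag) :
    SimpleGraph.binomialRandom V p {H | ∀ e ∈ S, e ∉ H.edgeSet} ≤
      ENNReal.ofReal (Real.exp (-(p * S.card))) := by
  rw [SimpleGraph.binomialRandom_apply']
  calc setBernoulli Sym2.diagSetᶜ p (SimpleGraph.edgeSet '' {H | ∀ e ∈ S, e ∉ H.edgeSet})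
    _ ≤ setBernoulli Sym2.diagSetᶜ p {s | ∀ e ∈ S, e ∉ s} :=
      measure_mono (Set.image_subset_iff.2 fun _ hH => hH)
    _ = ENNReal.ofReal ((1 - p) ^ S.card) := by
      rw [setBernoulli_forall_notMem p S (by simpa using hS), ← ENNReal.ofReal_coe_nnreal,
        ENNReal.ofReal_pow (by simp [p.2.2])]
      simp
    _ ≤ ENNReal.ofReal (Real.exp (-(p * S.card))) := by
      rw [mul_comm, ← mul_neg, Real.exp_nat_mul]
      gcongr
      · simp [p.2.2]
      · exact Real.one_sub_le_exp_neg p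

theorem exists_edges_of_pairs [Fintype V] (E : Set (V × V)) :
    ∃ S : Finset (Sym2 V), (∀ s ∈ S, ¬ s.IsDiag ∧ ∃ e ∈ E, s = s(e.1, e.2)) ∧
      E.ncard ≤ 2 * S.card + Fintype.card V := by
  classical
  set D : Finset (V × V) := {e ∈ E.toFinset | e.1 ≠ e.2}
  refine ⟨D.image fun e => s(e.1, e.2), ?_, ?_⟩
  · rintro s hs
    obtain ⟨e, he, rfl⟩ := Finset.mem_image.1 hs
    have he := Finset.mem_filter.1 he
    exact ⟨by simpa using he.2, e, by simpa using he.1, rfl⟩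
  have hD : D.card ≤ 2 * (D.image fun e => s(e.1, e.2)).card := by
    refine Finset.card_le_mul_card_image _ _ fun s _ => ?_
    induction s with | _ a b
    refine (Finset.card_le_card (t := {(a, b), (b, a)}) fun e he => ?_).trans Finset.card_le_two
    simpa [Prod.ext_iff, Sym2.eq_iff] using (Finset.mem_filter.1 he).2
  have hdiag : (E.toFinset.filter fun e => ¬ e.1 ≠ e.2).card ≤ Fintype.card V := by
    refine (Finset.card_le_card (t := Finset.univ.diag) fun e he => ?_).trans_eq (by simp)
    simpa using (Finset.mem_filter.1 he).2
  rw [Set.ncard_eq_toFinset_card', ← Finset.card_filter_add_card_filter_not fun e => e.1 ≠ e.2]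
  exact Nat.add_le_add hD hdiag

theorem binomialRandom_forall_not_adj_le [Fintype V] (p : I) (E : Set (V × V)) :
    SimpleGraph.binomialRandom V p {H | ∀ e ∈ E, ¬ H.Adj e.1 e.2} ≤
      ENNReal.ofReal (Real.exp (-(p * ((E.ncard - Fintype.card V) / 2)))) := by
  obtain ⟨S, hS, hcard⟩ := exists_edges_of_pairs E
  refine (measure_mono fun H hH s hs => ?_).trans
    ((binomialRandom_forall_notMem_edgeSet_le p S fun s hs => (hS s hs).1).trans ?_)
  · obtain ⟨e, he, rfl⟩ := (hS s hs).2
    exact hH e he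
  · have hcard' : (E.ncard : ℝ) ≤ 2 * S.card + Fintype.card V := by exact_mod_cast hcard
    have hp : (0 : ℝ) ≤ p := p.2.1
    gcongr
    linarith

end AvoidedEdges

section Realisation

variable {V ι : Type*}

/-- Some member of the family `𝓕` of labelled vertex choices maps all pairs of `M` to edges. -/
def Realises (H : SimpleGraph V) (M : List (ι × ι)) (𝓕 : Set (ι → V)) : Prop :=
  ∃ f ∈ 𝓕, ∀ e ∈ M, H.Adj (f e.1) (f e.2)

variable {M : List (ι × ι)} {𝓕 : Set (ι → V)} {e : ι × ι} {a : V × V}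

theorem Realises.cons [DecidableEq ι] {H : SimpleGraph V} (hM : IsMatching (e :: M))
    (ha : H.Adj a.1 a.2) (h : Realises H M {f | (exchange e.1 e.2 (a, f)).2 ∈ 𝓕}) :
    Realises H (e :: M) 𝓕 := by
  obtain ⟨f, hf, hfM⟩ := h
  simp only [IsMatching, endpoints, List.flatMap_cons, List.cons_append, List.nil_append,
    List.nodup_cons, List.mem_cons, not_or] at hM
  obtain ⟨⟨hne, h₁⟩, h₂, -⟩ := hM
  refine ⟨_, hf, List.forall_mem_cons.2 ⟨by simpa [exchange, hne] using ha, fun e' he' => ?_⟩⟩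
  have hmem : ∀ i, i = e'.1 ∨ i = e'.2 → i ∈ M.flatMap fun e => [e.1, e.2] := fun i hi =>
    List.mem_flatMap.2 ⟨e', he', by simpa using hi⟩
  have hfix : ∀ i, i = e'.1 ∨ i = e'.2 → (exchange e.1 e.2 (a, f)).2 i = f i := fun i hi => by
    simp only [exchange]
    rw [Function.update_of_ne (ne_of_mem_of_not_mem (hmem i hi) h₂),
      Function.update_of_ne (ne_of_mem_of_not_mem (hmem i hi) h₁)]
  rw [hfix _ (.inl rfl), hfix _ (.inr rfl)]
  exact hfM e' he'

variable [Fintype V]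

theorem measure_not_realises_cons_le [DecidableEq ι] (μ : Measure (SimpleGraph V)) {x y : ℝ≥0∞}
    (hM : IsMatching (e :: M)) {E : Set (V × V)} (hE : μ {H | ∀ a ∈ E, ¬ H.Adj a.1 a.2} ≤ x)
    (hrest : ∀ a ∈ E, μ {H | ¬ Realises H M {f | (exchange e.1 e.2 (a, f)).2 ∈ 𝓕}} ≤ y) :
    μ {H | ¬ Realises H (e :: M) 𝓕} ≤ x + (Fintype.card V : ℝ≥0∞) ^ 2 * y := by
  classical
  calc μ {H | ¬ Realises H (e :: M) 𝓕}
    _ ≤ μ ({H | ∀ a ∈ E, ¬ H.Adj a.1 a.2} ∪ ⋃ a ∈ E.toFinset,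
        {H | ¬ Realises H M {f | (exchange e.1 e.2 (a, f)).2 ∈ 𝓕}}) := by
      refine measure_mono fun H hH => or_iff_not_imp_left.2 fun hHE => ?_
      obtain ⟨a, ha, hHa⟩ : ∃ a ∈ E, H.Adj a.1 a.2 := by
        simpa only [Set.mem_ofPred_eq, not_forall, not_not, exists_prop] using hHE
      exact Set.mem_biUnion (Set.mem_toFinset.2 ha) fun h => hH (h.cons hM hHa)
    _ ≤ x + ∑ _ ∈ E.toFinset, y :=
      (measure_union_le _ _).trans (add_le_add hE ((measure_biUnion_finset_le _ _).trans
        (Finset.sum_le_sum fun a ha => hrest a (Set.mem_toFinset.1 ha))))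
    _ ≤ x + (Fintype.card V : ℝ≥0∞) ^ 2 * y := by
      have hcard := Finset.card_le_univ E.toFinset
      rw [Fintype.card_prod, ← sq] at hcard
      rw [Finset.sum_const, nsmul_eq_mul]
      gcongr
      exact_mod_cast hcard

variable [Fintype ι] [Nonempty V] {c : ℝ}

theorem le_ncard_rich_pairs [DecidableEq ι] (he : e.1 ≠ e.2) (hc : 0 ≤ c)
    (h𝓕 : c * (Fintype.card V : ℝ) ^ Fintype.card ι ≤ 𝓕.ncard) :
    c / 2 * (Fintype.card V : ℝ) ^ 2 ≤
      {a : V × V | c / 2 * (Fintype.card V : ℝ) ^ Fintype.card ι ≤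
        {f | (exchange e.1 e.2 (a, f)).2 ∈ 𝓕}.ncard}.ncard := by
  have hrich := le_ncard_rich_fiber (A := V × V) (B := ι → V)
    (S := {x | (exchange e.1 e.2 x).2 ∈ 𝓕}) hc ?_
  · simpa [sq] using hrich
  · rw [ncard_exchange_mem he]
    simp only [Fintype.card_prod, Nat.cast_mul, Fintype.card_pi, Finset.prod_const,
      Finset.card_univ, Nat.cast_pow]
    nlinarith

/-- The matching is revealed one edge at a time: having fixed the image of the first pair, the
family of completions is still rich, so the bound costs a factor `|V| ^ 2` for each pair. -/
theorem measure_not_realises_le (μ : Measure (SimpleGraph V)) {x : ℝ≥0∞} (hM : IsMatching M)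
    (hc : 0 < c)
    (hx : ∀ E : Set (V × V), c / 2 ^ M.length * (Fintype.card V : ℝ) ^ 2 ≤ E.ncard →
      μ {H | ∀ e ∈ E, ¬ H.Adj e.1 e.2} ≤ x)
    (h𝓕 : c * (Fintype.card V : ℝ) ^ Fintype.card ι ≤ 𝓕.ncard) :
    μ {H | ¬ Realises H M 𝓕} ≤ (1 + (Fintype.card V : ℝ≥0∞) ^ 2) ^ M.length * x := by
  classical
  induction M generalizing c 𝓕 with
  | nil =>
    obtain ⟨f, hf⟩ : 𝓕.Nonempty := by
      have hpos : (0 : ℝ) < 𝓕.ncard := lt_of_lt_of_le (by positivity) h𝓕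
      exact (Set.ncard_pos (Set.toFinite _)).1 (by exact_mod_cast hpos)
    have hempty : {H : SimpleGraph V | ¬ Realises H [] 𝓕} = ∅ :=
      Set.eq_empty_of_forall_notMem fun H hH => hH ⟨f, hf, by simp⟩
    simp [hempty]
  | cons e M ih =>
    have he : e.1 ≠ e.2 := by simpa using (List.nodup_append.1 hM).1
    have hrich := le_ncard_rich_pairs he hc.le h𝓕
    calc μ {H | ¬ Realises H (e :: M) 𝓕}
      _ ≤ x + (Fintype.card V : ℝ≥0∞) ^ 2 *
          ((1 + (Fintype.card V : ℝ≥0∞) ^ 2) ^ M.length * x) := by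
        refine measure_not_realises_cons_le μ hM (hx _ (hrich.trans' ?_)) fun a ha =>
          ih (List.nodup_append.1 hM).2.1 (half_pos hc)
            (by simpa only [List.length_cons, pow_succ', div_div] using hx) ha
        gcongr
        exact le_self_pow₀ one_le_two (by simp)
      _ ≤ (1 + (Fintype.card V : ℝ≥0∞) ^ 2) ^ M.length * x + (Fintype.card V : ℝ≥0∞) ^ 2 *
          ((1 + (Fintype.card V : ℝ≥0∞) ^ 2) ^ M.length * x) := by
        gcongr
        exact le_mul_of_one_le_left zero_le (one_le_pow₀ (by simp))
      _ = (1 + (Fintype.card V : ℝ≥0∞) ^ 2) ^ (e :: M).length * x := by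
        rw [List.length_cons, pow_succ]
        ring

/-- The family `𝓕 i` has an injective member mapping the pairs of `M` to edges of `H`, for each
index `i` for which `𝓕 i` has density at least `c` among all labelled vertex choices. -/
def MeetsRichFamilies {J : Type*} (H : SimpleGraph V) (M : List (ι × ι)) (c : ℝ)
    (𝓕 : J → Set (ι → V)) : Prop :=
  ∀ i, c * (Fintype.card V : ℝ) ^ Fintype.card ι ≤ (𝓕 i).ncard →
    Realises H M {f ∈ 𝓕 i | Function.Injective f}

theorem measure_not_meetsRichFamilies_le (μ : Measure (SimpleGraph V)) {x : ℝ≥0∞}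
    (hM : IsMatching M) (hc : 0 < c)
    (hι : 2 * (Fintype.card ι : ℝ) ^ 2 ≤ c * Fintype.card V)
    (hx : ∀ E : Set (V × V), c / 2 / 2 ^ M.length * (Fintype.card V : ℝ) ^ 2 ≤ E.ncard →
      μ {H | ∀ e ∈ E, ¬ H.Adj e.1 e.2} ≤ x)
    {J : Type*} [Fintype J] (𝓕 : J → Set (ι → V)) :
    μ {H | ¬ MeetsRichFamilies H M c 𝓕} ≤
      Fintype.card J * ((1 + (Fintype.card V : ℝ≥0∞) ^ 2) ^ M.length * x) := by
  classical
  set J' := Finset.univ.filter fun i =>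
    c * (Fintype.card V : ℝ) ^ Fintype.card ι ≤ ((𝓕 i).ncard : ℝ)
  calc μ {H | ¬ MeetsRichFamilies H M c 𝓕}
    _ ≤ μ (⋃ i ∈ J', {H | ¬ Realises H M {f ∈ 𝓕 i | Function.Injective f}}) := by
      refine measure_mono fun H hH => ?_
      obtain ⟨i, hi, hH⟩ : ∃ i, _ ∧ _ := by simpa [MeetsRichFamilies] using hH
      exact Set.mem_biUnion (by simpa [J'] using hi) hH
    _ ≤ ∑ i ∈ J', (1 + (Fintype.card V : ℝ≥0∞) ^ 2) ^ M.length * x :=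
      (measure_biUnion_finset_le _ _).trans <| Finset.sum_le_sum fun i hi =>
        measure_not_realises_le μ hM (half_pos hc) hx <|
          le_ncard_injective hι (Finset.mem_filter.1 hi).2
    _ ≤ Fintype.card J * ((1 + (Fintype.card V : ℝ≥0∞) ^ 2) ^ M.length * x) := by
      rw [Finset.sum_const, nsmul_eq_mul]
      gcongr
      exact Finset.card_le_univ J'

end Realisation

theorem binomialRandom_avoid_le_pow {V : Type*} [Fintype V] {p : I} {c : ℝ} {E : Set (V × V)}
    (hc : 2 ≤ c * Fintype.card V) (hp : 12 ≤ c * p * Fintype.card V)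
    (hE : c * (Fintype.card V : ℝ) ^ 2 ≤ E.ncard) :
    SimpleGraph.binomialRandom V p {H | ∀ e ∈ E, ¬ H.Adj e.1 e.2} ≤
      ENNReal.ofReal (Real.exp (-3)) ^ Fintype.card V := by
  refine (binomialRandom_forall_not_adj_le p E).trans ?_
  rw [← ENNReal.ofReal_pow (Real.exp_pos _).le, ← Real.exp_nat_mul]
  set n : ℝ := (Fintype.card V : ℝ)
  have hn : 0 ≤ n := Nat.cast_nonneg _
  have hhalf : c * n ^ 2 / 4 ≤ (E.ncard - n) / 2 := by nlinarith
  have hp' : p * (c * n ^ 2 / 4) ≤ p * ((E.ncard - n) / 2) :=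
    mul_le_mul_of_nonneg_left hhalf p.2.1
  gcongr
  nlinarith

theorem tendsto_union_bound (d r : ℕ) :
    Filter.Tendsto (fun n : ℕ => ((4 ^ n * n ^ d : ℕ) : ℝ≥0∞) *
      ((1 + (n : ℝ≥0∞) ^ 2) ^ r * ENNReal.ofReal (Real.exp (-3)) ^ n)) Filter.atTop (nhds 0) := by
  have hexp : |4 * Real.exp (-3)| < 1 := by
    rw [abs_of_pos (by positivity), Real.exp_neg, ← div_eq_mul_inv, div_lt_one (Real.exp_pos 3)]
    have := Real.add_one_lt_exp (x := 3) (by norm_num)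
    linarith
  have hlim := ENNReal.tendsto_ofReal
    ((tendsto_pow_const_mul_const_pow_of_abs_lt_one (d + 2 * r) hexp).const_mul (2 ^ r))
  rw [mul_zero, ENNReal.ofReal_zero] at hlim
  refine tendsto_of_tendsto_of_tendsto_of_le_of_le' tendsto_const_nhds hlim
    (Filter.Eventually.of_forall fun _ => zero_le) ?_
  filter_upwards [Filter.eventually_ge_atTop 1] with n hn
  have hsq : (1 : ℝ≥0∞) + n ^ 2 ≤ 2 * n ^ 2 := by
    rw [two_mul]
    gcongr
    exact one_le_pow₀ (by exact_mod_cast hn)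
  calc ((4 ^ n * n ^ d : ℕ) : ℝ≥0∞) *
        ((1 + (n : ℝ≥0∞) ^ 2) ^ r * ENNReal.ofReal (Real.exp (-3)) ^ n)
    _ ≤ (4 ^ n * n ^ d : ℕ) * ((2 * n ^ 2) ^ r * ENNReal.ofReal (Real.exp (-3)) ^ n) := by gcongr
    _ = ENNReal.ofReal (2 ^ r * (n ^ (d + 2 * r) * (4 * Real.exp (-3)) ^ n)) := by
      rw [ENNReal.ofReal_mul (by positivity), ENNReal.ofReal_mul (by positivity),
        ENNReal.ofReal_pow (by positivity), ENNReal.ofReal_pow (by positivity),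
        ENNReal.ofReal_pow (by positivity), ENNReal.ofReal_mul (by positivity)]
      simp only [ENNReal.ofReal_natCast, ENNReal.ofReal_ofNat]
      push_cast
      ring

theorem exists_tendsto_not_meetsRichFamilies {ι : Type*} [Fintype ι] {M : List (ι × ι)}
    (hM : IsMatching M) {c : ℝ} (hc : 0 < c) (d : ℕ) :
    ∃ C : ℝ, ∀ (p : ℕ → I) (J : ℕ → Type) [∀ n, Fintype (J n)]
      (𝓕 : ∀ n, J n → Set (ι → Fin n)),
      (∀ᶠ n : ℕ in Filter.atTop, C / n ≤ (p n : ℝ)) →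
      (∀ n, Fintype.card (J n) ≤ 4 ^ n * n ^ d) →
      Filter.Tendsto (fun n => SimpleGraph.binomialRandom (Fin n) (p n)
        {H | ¬ MeetsRichFamilies H M c (𝓕 n)}) Filter.atTop (nhds 0) := by
  set c' : ℝ := c / 2 / 2 ^ M.length
  have hc' : 0 < c' := by positivity
  refine ⟨12 / c', fun p J _ 𝓕 hp hJ => tendsto_of_tendsto_of_tendsto_of_le_of_le'
    tendsto_const_nhds (tendsto_union_bound d M.length)
    (Filter.Eventually.of_forall fun _ => zero_le) ?_⟩
  filter_upwards [hp, Filter.eventually_gt_atTop 0,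
    tendsto_natCast_atTop_atTop.eventually_ge_atTop (2 * (Fintype.card ι : ℝ) ^ 2 / c),
    tendsto_natCast_atTop_atTop.eventually_ge_atTop (2 / c')] with n hpn hn hnι hnc
  have : NeZero n := ⟨hn.ne'⟩
  rw [div_le_iff₀' hc] at hnι
  rw [div_le_iff₀' hc'] at hnc
  rw [div_div, div_le_iff₀' (by positivity), mul_right_comm] at hpn
  refine (measure_not_meetsRichFamilies_le _ hM hc (by simpa using hnι) (fun E hE =>
    binomialRandom_avoid_le_pow (by simpa using hnc) (by simpa using hpn) hE) (𝓕 n)).trans ?_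
  simp only [Fintype.card_fin]
  gcongr
  exact hJ n

end RandomGraphs

section AbsorberFamilies

variable {V : Type*}

/-- `T` is an `m`-path of `H` on `2 m` vertices. A vertex adjacent to all of them can be inserted
in its middle. -/
structure IsAbsorber (H : SimpleGraph V) (m : ℕ) (T : List V) : Prop where
  length_eq : T.length = 2 * m
  nodup : T.Nodup
  isPowerWalk : IsPowerWalk H.Adj m T

/-- The vertex `v` is adjacent to all vertices of the absorber `T`. -/
def Absorbs (H : SimpleGraph V) (T : List V) (v : V) : Prop :=
  ∀ a ∈ T, H.Adj v a

noncomputable instance {V : Type*} (H : SimpleGraph V) (T : List V) : DecidablePred (Absorbs H T) :=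
  Classical.decPred _

/-- Outside any set of at most `β |V|` vertices there is an absorber serving a proportion `c` of
the vertices of any prescribed nonempty set. -/
def HasAbsorbers [Fintype V] (H : SimpleGraph V) (m : ℕ) (c β : ℝ) : Prop :=
  ∀ R : Finset V, (R.card : ℝ) ≤ β * Fintype.card V → ∀ W : Finset V, W.Nonempty →
    ∃ T, IsAbsorber H m T ∧ (∀ a ∈ T, a ∉ R) ∧ c * W.card ≤ {v ∈ W | Absorbs H T v}.card

/-- `𝓐` is a set of pairwise disjoint absorbers avoiding `R`. -/
structure IsAbsorberFamily (H : SimpleGraph V) (m : ℕ) (R : Finset V) (𝓐 : Finset (List V)) :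
    Prop where
  isAbsorber : ∀ T ∈ 𝓐, IsAbsorber H m T
  avoids : ∀ T ∈ 𝓐, ∀ a ∈ T, a ∉ R
  disjoint : (𝓐 : Set (List V)).Pairwise List.Disjoint

/-- The number of absorbers in `𝓐` serving at least one vertex of `U`. -/
noncomputable def coverage (H : SimpleGraph V) (𝓐 : Finset (List V)) (U : Finset V) : ℕ :=
  {T ∈ 𝓐 | ∃ v ∈ U, Absorbs H T v}.card

/-- There are at most `b` disjoint absorbers avoiding `R` such that every set `U ⊆ W` of at most
`t` vertices meets Hall's condition: at least `|U|` of the absorbers serve a vertex of `U`. -/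
def HasHallFamily (H : SimpleGraph V) (m : ℕ) (t : ℕ) (b : ℝ) (R W : Finset V) : Prop :=
  ∃ 𝓐, IsAbsorberFamily H m R 𝓐 ∧ (𝓐.card : ℝ) ≤ b ∧
    ∀ U ⊆ W, U.card ≤ t → U.card ≤ coverage H 𝓐 U

variable {H : SimpleGraph V} {m s t J : ℕ} {R W U U' : Finset V} {𝓐 𝓑 : Finset (List V)}
  {T : List V} {c β b : ℝ}

theorem coverage_mono (h𝓐 : 𝓐 ⊆ 𝓑) (hU : U ⊆ U') : coverage H 𝓐 U ≤ coverage H 𝓑 U' :=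
  Finset.card_le_card fun T hT => by
    obtain ⟨hT, v, hv, hTv⟩ := Finset.mem_filter.1 hT
    exact Finset.mem_filter.2 ⟨h𝓐 hT, v, hU hv, hTv⟩

theorem exists_injOn_absorbs (hU : ∀ U' ⊆ U, U'.card ≤ coverage H 𝓐 U') :
    ∃ φ : V → List V, Set.InjOn φ U ∧ ∀ v ∈ U, φ v ∈ 𝓐 ∧ Absorbs H (φ v) v := by
  classical
  obtain ⟨ψ, hψ_inj, hψ⟩ := (Finset.all_card_le_biUnion_card_iff_exists_injective
    fun v : U => {T ∈ 𝓐 | Absorbs H T v}).1 fun s => by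
      rw [← Finset.card_map (Function.Embedding.subtype _)]
      refine (hU _ (Finset.map_subtype_subset s)).trans (Finset.card_le_card fun T hT => ?_)
      obtain ⟨hT, v, hv, hTv⟩ := Finset.mem_filter.1 hT
      obtain ⟨w, hw, rfl⟩ := Finset.mem_map.1 hv
      exact Finset.mem_biUnion.2 ⟨w, hw, Finset.mem_filter.2 ⟨hT, hTv⟩⟩
  refine ⟨fun v => if hv : v ∈ U then ψ ⟨v, hv⟩ else [], fun v hv w hw h => ?_, fun v hv => ?_⟩
  · rw [Finset.mem_coe] at hv hw
    simpa [hv, hw, hψ_inj.eq_iff] using h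
  · simpa [hv] using hψ ⟨v, hv⟩

theorem IsAbsorberFamily.empty : IsAbsorberFamily H m R ∅ where
  isAbsorber := by simp
  avoids := by simp
  disjoint := by simp

theorem hasHallFamily_of_eq_zero (hb : 0 ≤ b) (h : t = 0 ∨ W = ∅) : HasHallFamily H m t b R W :=
  ⟨∅, .empty, by simpa using hb, fun U hU hUt => by
    obtain rfl : U = ∅ := by
      rcases h with rfl | rfl
      · simpa using hUt
      · simpa using hU
    simp⟩

/-- The vertices of the absorbers in `𝓐`. -/
noncomputable def familyVertices [DecidableEq V] (𝓐 : Finset (List V)) : Finset V :=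
  𝓐.biUnion List.toFinset

theorem mem_familyVertices [DecidableEq V] {a : V} : a ∈ familyVertices 𝓐 ↔ ∃ T ∈ 𝓐, a ∈ T := by
  simp [familyVertices]

theorem IsAbsorberFamily.card_union_vertices_le [DecidableEq V] (h𝓐 : IsAbsorberFamily H m R 𝓐) :
    (R ∪ familyVertices 𝓐).card ≤ R.card + 2 * m * 𝓐.card := by
  refine (Finset.card_union_le _ _).trans (Nat.add_le_add_left ?_ _)
  rw [mul_comm]
  exact Finset.card_biUnion_le_card_mul _ _ _ fun T hT =>
    (List.toFinset_card_le T).trans_eq (h𝓐.isAbsorber T hT).length_eq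

theorem IsAbsorberFamily.union [DecidableEq V] (h𝓐 : IsAbsorberFamily H m R 𝓐)
    (h𝓑 : IsAbsorberFamily H m (R ∪ familyVertices 𝓐) 𝓑) : IsAbsorberFamily H m R (𝓐 ∪ 𝓑) where
  isAbsorber T hT := (Finset.mem_union.1 hT).elim (h𝓐.isAbsorber T) (h𝓑.isAbsorber T)
  avoids T hT a ha := (Finset.mem_union.1 hT).elim (h𝓐.avoids T · a ha) fun hT haR =>
    h𝓑.avoids T hT a ha (Finset.mem_union_left _ haR)
  disjoint := by
    have : Std.Symm (List.Disjoint (α := V)) := ⟨fun _ _ h => h.symm⟩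
    rw [Finset.coe_union, Set.pairwise_union_of_symm]
    exact ⟨h𝓐.disjoint, h𝓑.disjoint, fun T hT T' hT' _ a ha ha' =>
      h𝓑.avoids T' hT' a ha' (Finset.mem_union_right _ (mem_familyVertices.2 ⟨T, hT, ha⟩))⟩

theorem IsAbsorber.isAbsorberFamily_singleton (hT : IsAbsorber H m T) (hTR : ∀ a ∈ T, a ∉ R) :
    IsAbsorberFamily H m R {T} where
  isAbsorber := by simpa using hT
  avoids := by simpa using hTR
  disjoint := by simp

theorem sum_min_coverage_insert [DecidableEq V] (hT : T ∉ 𝓐) (t : ℕ) (W : Finset V) :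
    ∑ v ∈ W, min (coverage H 𝓐 {v}) t +
        {v ∈ W | coverage H 𝓐 {v} < t ∧ Absorbs H T v}.card ≤
      ∑ v ∈ W, min (coverage H (𝓐 ∪ {T}) {v}) t := by
  rw [Finset.card_filter, ← Finset.sum_add_distrib]
  refine Finset.sum_le_sum fun v _ => ?_
  split_ifs with hv
  · have hinsert : coverage H (𝓐 ∪ {T}) {v} = coverage H 𝓐 {v} + 1 := by
      simp only [coverage, Finset.mem_singleton, exists_eq_left, Finset.filter_union,
        Finset.filter_singleton, hv.2, if_true]
      rw [Finset.card_union_of_disjoint (by simp [hT]), Finset.card_singleton]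
    omega
  · exact min_le_min_right t (coverage_mono Finset.subset_union_left subset_rfl)

variable [Fintype V]

theorem IsAbsorberFamily.exists_union_singleton [DecidableEq V]
    (h𝓐 : IsAbsorberFamily H m R 𝓐) (hm : m ≠ 0) (hH : HasAbsorbers H m c β)
    (hR : (R.card : ℝ) + 2 * m * 𝓐.card ≤ β * Fintype.card V)
    (hW : W.Nonempty) :
    ∃ T ∉ 𝓐, IsAbsorberFamily H m R (𝓐 ∪ {T}) ∧ c * W.card ≤ {v ∈ W | Absorbs H T v}.card := by
  have hR' : ((R ∪ familyVertices 𝓐).card : ℝ) ≤ β * Fintype.card V :=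
    le_trans (by exact_mod_cast h𝓐.card_union_vertices_le) hR
  obtain ⟨T, hT, hTR, hTW⟩ := hH _ hR' W hW
  refine ⟨T, fun hT𝓐 => ?_, h𝓐.union (hT.isAbsorberFamily_singleton hTR), hTW⟩
  obtain ⟨a, ha⟩ := List.exists_mem_of_length_pos (l := T) (by have := hT.length_eq; omega)
  exact hTR a ha (Finset.mem_union_right _ (mem_familyVertices.2 ⟨T, hT𝓐, ha⟩))

/-- Add absorbers serving many of the vertices not yet served `t` times. Unless at most half of `W`
is left, each of them raises the truncated coverage of `W` by a fixed amount. -/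
theorem HasAbsorbers.exists_coverage_or (hH : HasAbsorbers H m c β) (hm : m ≠ 0) (hc : 0 ≤ c)
    (hR : (R.card : ℝ) + 2 * m * s ≤ β * Fintype.card V) :
    ∃ 𝓐, IsAbsorberFamily H m R 𝓐 ∧ 𝓐.card ≤ s ∧
      (2 * {v ∈ W | coverage H 𝓐 {v} < t}.card ≤ W.card ∨
        c * W.card / 2 * s ≤ (∑ v ∈ W, min (coverage H 𝓐 {v}) t : ℕ)) := by
  classical
  induction s with
  | zero => exact ⟨∅, .empty, le_rfl, .inr (by simpa using by positivity)⟩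
  | succ s ih =>
    have hR' : (R.card : ℝ) + 2 * m * s ≤ β * Fintype.card V := hR.trans' (by gcongr; simp)
    obtain ⟨𝓐, h𝓐, hcard, hcov⟩ := ih hR'
    by_cases hW : 2 * {v ∈ W | coverage H 𝓐 {v} < t}.card ≤ W.card
    · exact ⟨𝓐, h𝓐, hcard.trans s.le_succ, .inl hW⟩
    · obtain ⟨T, hT, h𝓐T, hTW⟩ := h𝓐.exists_union_singleton hm hH (hR'.trans' (by gcongr))
        (W := {v ∈ W | coverage H 𝓐 {v} < t}) (Finset.card_pos.1 (by omega))
      refine ⟨𝓐 ∪ {T}, h𝓐T, (Finset.card_union_le _ _).trans (by simpa using hcard), .inr ?_⟩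
      have hgain : ((∑ v ∈ W, min (coverage H 𝓐 {v}) t : ℕ) : ℝ) +
          {v ∈ W | coverage H 𝓐 {v} < t ∧ Absorbs H T v}.card ≤
          (∑ v ∈ W, min (coverage H (𝓐 ∪ {T}) {v}) t : ℕ) := by
        exact_mod_cast sum_min_coverage_insert hT t W
      rw [Finset.filter_filter] at hTW
      have hhalf : (W.card : ℝ) ≤ 2 * {v ∈ W | coverage H 𝓐 {v} < t}.card := by
        exact_mod_cast (not_le.1 hW).le
      have hcov := hcov.resolve_left hW
      push_cast at hgain hcov ⊢
      nlinarith

theorem HasAbsorbers.exists_covering_half (hH : HasAbsorbers H m c β) (hm : m ≠ 0) (hc : 0 < c)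
    (hc1 : c ≤ 1) (ht : t ≠ 0) (hW : W.Nonempty)
    (hR : (R.card : ℝ) + 2 * m * (3 * t / c) ≤ β * Fintype.card V) :
    ∃ 𝓐, IsAbsorberFamily H m R 𝓐 ∧ (𝓐.card : ℝ) ≤ 3 * t / c ∧
      2 * {v ∈ W | coverage H 𝓐 {v} < t}.card ≤ W.card := by
  set s : ℕ := ⌊(2 * t / c : ℝ)⌋₊ + 1
  have hs : (2 * t / c : ℝ) < s := (Nat.lt_floor_add_one _).trans_eq (by push_cast [s]; rfl)
  have hs' : (s : ℝ) ≤ 3 * t / c := by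
    have hfloor : (⌊2 * t / c⌋₊ : ℝ) ≤ 2 * t / c := Nat.floor_le (by positivity)
    have ht1 : (1 : ℝ) ≤ t := by exact_mod_cast Nat.one_le_iff_ne_zero.2 ht
    have htc : 1 ≤ t / c := (one_le_div hc).2 (hc1.trans ht1)
    calc (s : ℝ) = ⌊2 * t / c⌋₊ + 1 := by push_cast [s]; rfl
      _ ≤ 2 * t / c + t / c := add_le_add hfloor htc
      _ = 3 * t / c := by ring
  obtain ⟨𝓐, h𝓐, hcard, hcov⟩ :=
    hH.exists_coverage_or (W := W) (t := t) hm hc.le (hR.trans' (by gcongr))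
  refine ⟨𝓐, h𝓐, hs'.trans' (by exact_mod_cast hcard), hcov.resolve_right fun hsum => ?_⟩
  have hle : ((∑ v ∈ W, min (coverage H 𝓐 {v}) t : ℕ) : ℝ) ≤ W.card * t := by
    exact_mod_cast Finset.sum_le_card_nsmul W _ _ fun v _ => min_le_right _ _
  have hWpos : (0 : ℝ) < W.card := by exact_mod_cast hW.card_pos
  rw [div_lt_iff₀ hc] at hs
  nlinarith

theorem HasAbsorbers.hasHallFamily_add (hH : HasAbsorbers H m c β) (hm : m ≠ 0) (hc : 0 < c)
    (hc1 : c ≤ 1) (ht : t ≠ 0) (hW : W.Nonempty) (hb : 0 ≤ b)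
    (hR : (R.card : ℝ) + 2 * m * (3 * t / c + b) ≤ β * Fintype.card V)
    (hhalf : ∀ R' W' : Finset V, 2 * W'.card ≤ W.card →
      (R'.card : ℝ) + 2 * m * b ≤ β * Fintype.card V → HasHallFamily H m t b R' W') :
    HasHallFamily H m t (3 * t / c + b) R W := by
  classical
  obtain ⟨𝓐, h𝓐, h𝓐card, h𝓐W⟩ :=
    hH.exists_covering_half hm hc hc1 ht hW (hR.trans' (by gcongr; exact le_add_of_nonneg_right hb))
  have hR' : ((R ∪ familyVertices 𝓐).card : ℝ) + 2 * m * b ≤ β * Fintype.card V := by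
    have hle : ((R ∪ familyVertices 𝓐).card : ℝ) ≤ R.card + 2 * m * 𝓐.card := by
      exact_mod_cast h𝓐.card_union_vertices_le
    have hmul : (2 * m * 𝓐.card : ℝ) ≤ 2 * m * (3 * t / c) := by gcongr
    linarith
  obtain ⟨𝓑, h𝓑, h𝓑card, h𝓑W⟩ := hhalf _ _ h𝓐W hR'
  refine ⟨𝓐 ∪ 𝓑, h𝓐.union h𝓑, ?_, fun U hUW hUt => ?_⟩
  · have hle : ((𝓐 ∪ 𝓑).card : ℝ) ≤ 𝓐.card + 𝓑.card := by
      exact_mod_cast Finset.card_union_le 𝓐 𝓑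
    linarith
  by_cases hU : U ⊆ {v ∈ W | coverage H 𝓐 {v} < t}
  · exact (h𝓑W U hU hUt).trans (coverage_mono Finset.subset_union_right subset_rfl)
  · obtain ⟨v, hv, hvt⟩ := Finset.not_subset.1 hU
    have hvt : t ≤ coverage H 𝓐 {v} := by simpa [hUW hv] using hvt
    exact hUt.trans (hvt.trans
      (coverage_mono Finset.subset_union_left (Finset.singleton_subset_iff.2 hv)))

theorem HasAbsorbers.hasHallFamily_card (hH : HasAbsorbers H m c β) (hm : m ≠ 0) (hc : 0 < c)
    (hc1 : c ≤ 1) (hR : (R.card : ℝ) + 2 * m * (6 * W.card / c) ≤ β * Fintype.card V) :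
    HasHallFamily H m W.card (6 * W.card / c) R W := by
  induction hw : W.card using Nat.strong_induction_on generalizing W R with
  | _ w ih =>
  subst hw
  rcases W.eq_empty_or_nonempty with rfl | hW
  · exact hasHallFamily_of_eq_zero (by positivity) (.inr rfl)
  have hsum : (6 * W.card / c : ℝ) = 3 * W.card / c + 3 * W.card / c := by ring
  rw [hsum] at hR ⊢
  refine hH.hasHallFamily_add hm hc hc1 hW.card_pos.ne' hW (by positivity) hR
    fun R' W' hW' hR' => ?_
  have hle : (6 * W'.card / c : ℝ) ≤ 3 * W.card / c := by
    have : (2 * W'.card : ℝ) ≤ W.card := by exact_mod_cast hW'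
    gcongr ?_ / c
    linarith
  obtain ⟨𝓐, h𝓐, hcard, hU⟩ :=
    ih W'.card (by have := hW.card_pos; omega) (hR'.trans' (by gcongr)) rfl
  exact ⟨𝓐, h𝓐, hcard.trans hle, fun U hUW _ => hU U hUW (Finset.card_le_card hUW)⟩

theorem HasAbsorbers.hasHallFamily (hH : HasAbsorbers H m c β) (hm : m ≠ 0) (hc : 0 < c)
    (hc1 : c ≤ 1) (hW : W.card ≤ 2 ^ J * t)
    (hR : (R.card : ℝ) + 2 * m * ((6 + 3 * J) * t / c) ≤ β * Fintype.card V) :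
    HasHallFamily H m t ((6 + 3 * J) * t / c) R W := by
  rcases eq_or_ne t 0 with rfl | ht
  · exact hasHallFamily_of_eq_zero (by simp) (.inl rfl)
  induction J generalizing W R with
  | zero =>
    have hle : (6 * W.card / c : ℝ) ≤ (6 + 3 * (0 : ℕ)) * t / c := by
      have : (W.card : ℝ) ≤ t := by exact_mod_cast (by simpa using hW)
      simp only [Nat.cast_zero, mul_zero, add_zero]
      gcongr
    obtain ⟨𝓐, h𝓐, hcard, hU⟩ := hH.hasHallFamily_card hm hc hc1 (hR.trans' (by gcongr))
    exact ⟨𝓐, h𝓐, hcard.trans hle, fun U hUW _ => hU U hUW (Finset.card_le_card hUW)⟩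
  | succ J ih =>
    rcases W.eq_empty_or_nonempty with rfl | hWne
    · exact hasHallFamily_of_eq_zero (by positivity) (.inr rfl)
    have hsum : ((6 + 3 * (J + 1 : ℕ)) * t / c : ℝ) = 3 * t / c + (6 + 3 * J) * t / c := by
      push_cast
      ring
    rw [hsum] at hR ⊢
    refine hH.hasHallFamily_add hm hc hc1 ht hWne (by positivity) hR fun R' W' hW' hR' =>
      ih ?_ hR'
    rw [pow_succ] at hW
    linarith

end AbsorberFamilies

section Chains

variable {V : Type*}

/-- The list `s` inserted in the middle of an absorber `T` for exponent `m`. -/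
def insertMiddle (m : ℕ) (s T : List V) : List V :=
  T.take m ++ s ++ T.drop m

/-- The absorbers `T, T₁, T₂, …` strung together by the connectors `C₁, C₂, …`, for the list
`L = [(C₁, T₁), (C₂, T₂), …]`, with `τ` giving the vertices inserted in each absorber. -/
def chain (m : ℕ) (τ : List V → List V) (T : List V) (L : List (List V × List V)) : List V :=
  insertMiddle m (τ T) T ++ L.flatMap fun e => e.1 ++ insertMiddle m (τ e.2) e.2

/-- Each connector continues the end of the preceding absorber to the start of the next one. -/
def IsLinked (H : SimpleGraph V) (m : ℕ) : List V → List (List V × List V) → Prop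
  | _, [] => True
  | T, e :: L => IsPowerWalk H.Adj m (T.drop m ++ e.1 ++ e.2.take m) ∧ IsLinked H m e.2 L

variable {H : SimpleGraph V} {m k ℓ : ℕ} {β γ : ℝ} {T : List V} {L : List (List V × List V)}
  {τ : List V → List V}

theorem insertMiddle_nil (m : ℕ) (T : List V) : insertMiddle m [] T = T := by
  simp [insertMiddle]

theorem chain_cons (m : ℕ) (τ : List V → List V) (T : List V) (e : List V × List V)
    (L : List (List V × List V)) :
    chain m τ T (e :: L) = insertMiddle m (τ T) T ++ e.1 ++ chain m τ e.2 L := by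
  simp [chain]

theorem IsLinked.isPowerWalk_chain (hL : IsLinked H m T L)
    (hT : ∀ S ∈ T :: L.map Prod.snd,
      S.length = 2 * m ∧ IsPowerWalk H.Adj m (insertMiddle m (τ S) S)) :
    IsPowerWalk H.Adj m (chain m τ T L) := by
  induction L generalizing T with
  | nil => simpa [chain] using (hT T (by simp)).2
  | cons e L ih =>
    obtain ⟨hTe, hL⟩ := hL
    have hrest := ih hL fun S hS => hT S (List.mem_cons_of_mem _ hS)
    obtain ⟨hTlen, hTwalk⟩ := hT T (by simp)
    have helen := (hT e.2 (by simp)).1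
    have hstart : IsPowerWalk H.Adj m (insertMiddle m (τ T) T ++ (e.1 ++ e.2.take m)) :=
      hTwalk.append_of_overlap (by simpa using hTe) (by simp; omega)
    obtain ⟨s, hs⟩ : ∃ s, chain m τ e.2 L = e.2.take m ++ s := ⟨_, by
      rw [chain, insertMiddle, List.append_assoc, List.append_assoc]⟩
    rw [hs] at hrest
    rw [chain_cons, hs, ← List.append_assoc]
    exact IsPowerWalk.append_of_overlap (by simpa using hstart) hrest (by simp; omega)

theorem chain_perm (m : ℕ) (τ : List V → List V) (T : List V) (L : List (List V × List V)) :
    (chain m τ T L).Perm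
      (chain m (fun _ => []) T L ++ (T :: L.map Prod.snd).flatMap τ) := by
  induction L generalizing T with
  | nil =>
    rw [← Multiset.coe_eq_coe]
    simp only [chain, insertMiddle, List.flatMap_nil, List.append_nil, List.map_nil,
      List.flatMap_cons, ← Multiset.coe_add]
    abel
  | cons e L ih =>
    have ih := ih e.2
    rw [← Multiset.coe_eq_coe] at ih ⊢
    simp only [chain_cons, insertMiddle, List.map_cons, List.flatMap_cons, List.append_nil,
      ← Multiset.coe_add] at ih ⊢
    rw [ih]
    abel

theorem chain_nil_perm (m : ℕ) (T : List V) (L : List (List V × List V)) :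
    (chain m (fun _ => []) T L).Perm
      ((T :: L.map Prod.snd).flatten ++ L.flatMap Prod.fst) := by
  induction L generalizing T with
  | nil => simp [chain, insertMiddle_nil]
  | cons e L ih =>
    have ih := ih e.2
    rw [← Multiset.coe_eq_coe] at ih ⊢
    simp only [chain_cons, insertMiddle_nil, List.map_cons, List.flatten_cons, List.flatMap_cons,
      ← Multiset.coe_add] at ih ⊢
    rw [ih]
    abel

theorem le_length_chain (hT : m ≤ T.length) : m ≤ (chain m τ T L).length := by
  simp only [chain, insertMiddle, List.length_append, List.length_take]
  omega

theorem firstEnd_chain (hT : m ≤ T.length) : firstEnd m (chain m τ T L) = T.take m := by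
  rw [firstEnd, chain, insertMiddle, List.append_assoc, List.append_assoc]
  exact List.take_left' (List.length_take_of_le hT)

theorem lastEnd_append {l l' : List V} (hl : m ≤ l'.length) :
    lastEnd m (l ++ l') = lastEnd m l' := by
  rw [lastEnd, lastEnd, List.length_append, Nat.add_sub_assoc hl, List.drop_length_add_append]

theorem lastEnd_chain_eq (hT : ∀ S ∈ T :: L.map Prod.snd, S.length = 2 * m)
    (τ τ' : List V → List V) :
    lastEnd m (chain m τ T L) = lastEnd m (chain m τ' T L) := by
  induction L generalizing T with
  | nil =>
    have hlen : m ≤ (T.drop m).length := by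
      have := hT T (by simp)
      simp only [List.length_drop]
      omega
    simp only [chain, insertMiddle, List.flatMap_nil, List.append_nil, lastEnd_append hlen]
  | cons e L ih =>
    have hT' : ∀ S ∈ e.2 :: L.map Prod.snd, S.length = 2 * m := fun S hS =>
      hT S (List.mem_cons_of_mem _ hS)
    have hlen : ∀ τ, m ≤ (chain m τ e.2 L).length := fun τ =>
      le_length_chain (by have := hT' e.2 (by simp); omega)
    rw [chain_cons, chain_cons, lastEnd_append (hlen τ), lastEnd_append (hlen τ'), ih hT']

/-- Disjoint absorbers strung together by disjoint connectors. -/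
structure IsAbsorberChain (H : SimpleGraph V) (m : ℕ) (T : List V) (L : List (List V × List V)) :
    Prop where
  isAbsorber : ∀ S ∈ T :: L.map Prod.snd, IsAbsorber H m S
  isLinked : IsLinked H m T L
  nodup_absorbers : (T :: L.map Prod.snd).Nodup
  nodup : (chain m (fun _ => []) T L).Nodup

theorem IsAbsorberChain.isPowerPath_chain (h : IsAbsorberChain H m T L)
    (hτ : ∀ S ∈ T :: L.map Prod.snd, IsPowerWalk H.Adj m (insertMiddle m (τ S) S))
    (hnd : (chain m τ T L).Nodup) : IsPowerPath H m (chain m τ T L) := by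
  refine (h.isLinked.isPowerWalk_chain fun S hS => ⟨(h.isAbsorber S hS).length_eq, hτ S hS⟩)
    |>.isPowerPath hnd (le_length_chain ?_)
  have := (h.isAbsorber T (by simp)).length_eq
  omega

theorem IsAbsorber.isPowerWalk_insertMiddle (hT : IsAbsorber H (k + 1) T) {s : List V}
    (hs : s.length ≤ 1) (hsT : ∀ v ∈ s, Absorbs H T v) :
    IsPowerWalk H.Adj (k + 1) (insertMiddle (k + 1) s T) := by
  match s with
  | [] => simpa [insertMiddle_nil] using hT.isPowerWalk
  | [v] =>
    have hv := hsT v (by simp)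
    have hlen := hT.length_eq
    rw [insertMiddle, List.append_assoc]
    refine IsPowerWalk.insert_middle (by simpa using hT.isPowerWalk) (by simp; omega) ?_ ?_
    · exact fun a ha => (hv a (List.mem_of_mem_take ha)).symm
    · exact fun a ha => hv a (List.mem_of_mem_drop ha)

theorem length_filter_eq_le_one {ι : Type*} [DecidableEq ι] {φ : V → ι} {U : Finset V}
    (hφ : Set.InjOn φ U) (i : ι) : (U.toList.filter (φ · = i)).length ≤ 1 := by
  have hcard : (U.filter (φ · = i)).card ≤ 1 := Finset.card_le_one.2 fun v hv w hw => by
    rw [Finset.mem_filter] at hv hw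
    exact hφ hv.1 hw.1 (hv.2.trans hw.2.symm)
  rwa [← Multiset.coe_card, ← Multiset.filter_coe, Finset.coe_toList]

theorem flatMap_filter_eq_perm {ι : Type*} [DecidableEq ι] {φ : V → ι} {U : Finset V}
    {l : List ι} (hl : l.Nodup) (hφ : ∀ v ∈ U, φ v ∈ l) :
    (l.flatMap fun i => U.toList.filter (φ · = i)).Perm U.toList := by
  refine (List.perm_ext_iff_of_nodup ?_ U.nodup_toList).2 fun v => ?_
  · refine List.nodup_flatMap.2 ⟨fun i _ => U.nodup_toList.filter _, hl.imp fun hij v hv hw => ?_⟩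
    simp only [List.mem_filter, decide_eq_true_eq] at hv hw
    exact hij (hv.2.symm.trans hw.2)
  · simpa using hφ v

theorem IsAbsorberChain.exists_absorbing (h : IsAbsorberChain H (k + 1) T L) {U : Finset V}
    {φ : V → List V} (hφ : Set.InjOn φ U)
    (hφU : ∀ v ∈ U, φ v ∈ T :: L.map Prod.snd ∧ Absorbs H (φ v) v)
    (hU : ∀ v ∈ U, v ∉ chain (k + 1) (fun _ => []) T L) :
    ∃ B, IsPowerPath H (k + 1) B ∧ (∀ v, v ∈ B ↔ v ∈ chain (k + 1) (fun _ => []) T L ∨ v ∈ U) ∧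
      firstEnd (k + 1) B = firstEnd (k + 1) (chain (k + 1) (fun _ => []) T L) ∧
      lastEnd (k + 1) B = lastEnd (k + 1) (chain (k + 1) (fun _ => []) T L) := by
  classical
  set τ : List V → List V := fun S => U.toList.filter (φ · = S)
  have hperm : (chain (k + 1) τ T L).Perm (chain (k + 1) (fun _ => []) T L ++ U.toList) :=
    (chain_perm _ _ _ _).trans
      ((flatMap_filter_eq_perm h.nodup_absorbers fun v hv => (hφU v hv).1).append_left _)
  have hnodup : (chain (k + 1) τ T L).Nodup := by
    refine hperm.nodup_iff.2 (h.nodup.append U.nodup_toList fun v hv hvU => ?_)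
    exact hU v (Finset.mem_toList.1 hvU) hv
  have hTlen : k + 1 ≤ T.length := by
    have := (h.isAbsorber T (by simp)).length_eq
    omega
  refine ⟨_, h.isPowerPath_chain (fun S hS => ?_) hnodup, fun v => ?_, ?_, ?_⟩
  · refine (h.isAbsorber S hS).isPowerWalk_insertMiddle (length_filter_eq_le_one hφ S) ?_
    intro v hv
    obtain ⟨hvU, rfl⟩ : v ∈ U ∧ φ v = S := by simpa [τ] using hv
    exact (hφU v hvU).2
  · rw [hperm.mem_iff, List.mem_append, Finset.mem_toList]
  · rw [firstEnd_chain hTlen, firstEnd_chain hTlen]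
  · exact lastEnd_chain_eq (fun S hS => (h.isAbsorber S hS).length_eq) _ _

variable [Fintype V]

/-- Any two cliques on `m` vertices are joined by an `m`-walk with `ℓ` inner vertices, which are
distinct and avoid a prescribed set of at most `β |V|` vertices. -/
def HasConnections (H : SimpleGraph V) (m ℓ : ℕ) (β : ℝ) : Prop :=
  ∀ R : Finset V, (R.card : ℝ) ≤ β * Fintype.card V → ∀ x z : List V, x.length = m →
    z.length = m → x.Pairwise H.Adj → z.Pairwise H.Adj →
    ∃ C : List V, C.length = ℓ ∧ C.Nodup ∧ (∀ a ∈ C, a ∉ R) ∧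
      IsPowerWalk H.Adj m (x ++ C ++ z)

theorem HasConnections.exists_isLinked (hH : HasConnections H m ℓ β) {𝓐 : List (List V)}
    (hT : ∀ S ∈ T :: 𝓐, IsAbsorber H m S) {R : Finset V}
    (hR : (R.card : ℝ) + ℓ * 𝓐.length ≤ β * Fintype.card V) :
    ∃ L : List (List V × List V), L.map Prod.snd = 𝓐 ∧ IsLinked H m T L ∧
      (L.flatMap Prod.fst).Nodup ∧ (∀ a ∈ L.flatMap Prod.fst, a ∉ R) ∧
      (L.flatMap Prod.fst).length = ℓ * 𝓐.length := by
  classical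
  induction 𝓐 generalizing T R with
  | nil => exact ⟨[], rfl, trivial, by simp, by simp, by simp⟩
  | cons S 𝓐 ih =>
    rw [List.length_cons, Nat.cast_succ] at hR
    have hTabs := hT T (by simp)
    have hSabs := hT S (by simp)
    have hTlen := hTabs.length_eq
    have hSlen := hSabs.length_eq
    obtain ⟨C, hClen, hCnd, hCR, hCwalk⟩ := hH R
      (hR.trans' (le_add_of_nonneg_right (by positivity))) (T.drop m) (S.take m)
      (by simp; omega) (by simp; omega)
      ((hTabs.isPowerWalk.of_isInfix (List.drop_suffix m T).isInfix).pairwise (by simp; omega))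
      ((hSabs.isPowerWalk.of_isInfix (List.take_prefix m S).isInfix).pairwise (by simp))
    have hcard : ((R ∪ C.toFinset).card : ℝ) ≤ R.card + ℓ := by
      exact_mod_cast hClen ▸ (Finset.card_union_le R C.toFinset).trans
        (Nat.add_le_add_left (List.toFinset_card_le C) _)
    obtain ⟨L, rfl, hlink, hLnd, hLR, hLlen⟩ := ih (T := S) (R := R ∪ C.toFinset)
      (fun S' hS' => hT S' (List.mem_cons_of_mem _ hS')) (by linarith)
    refine ⟨(C, S) :: L, by simp, ⟨hCwalk, hlink⟩, ?_, ?_, ?_⟩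
    · rw [List.flatMap_cons]
      exact hCnd.append hLnd fun a haC haL => hLR a haL (by simp [haC])
    · rw [List.flatMap_cons, List.forall_mem_append]
      exact ⟨hCR, fun a ha haR => hLR a ha (Finset.mem_union_left _ haR)⟩
    · rw [List.flatMap_cons, List.length_append, hLlen, hClen, List.length_cons]
      ring

theorem HasConnections.exists_isAbsorberChain (hH : HasConnections H m ℓ β) {R : Finset V}
    {𝓐 : Finset (List V)} (h𝓐 : IsAbsorberFamily H m R 𝓐) (hne : 𝓐.Nonempty)
    (hR : (R.card : ℝ) + 𝓐.card * (2 * m + ℓ) ≤ β * Fintype.card V) :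
    ∃ T L, IsAbsorberChain H m T L ∧ (∀ S, S ∈ T :: L.map Prod.snd ↔ S ∈ 𝓐) ∧
      (∀ v ∈ chain m (fun _ => []) T L, v ∉ R) ∧
      (chain m (fun _ => []) T L).length ≤ 𝓐.card * (2 * m + ℓ) := by
  classical
  obtain ⟨T, 𝓣, hT𝓣⟩ : ∃ T 𝓣, 𝓐.toList = T :: 𝓣 :=
    List.exists_cons_of_ne_nil (by simpa using hne.ne_empty)
  have hmem : ∀ S, S ∈ T :: 𝓣 ↔ S ∈ 𝓐 := fun S => by rw [← hT𝓣, Finset.mem_toList]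
  have hlen : 𝓐.card = 𝓣.length + 1 := by
    rw [← Finset.length_toList, hT𝓣, List.length_cons]
  have habs : ∀ S ∈ T :: 𝓣, IsAbsorber H m S := fun S hS => h𝓐.isAbsorber S ((hmem S).1 hS)
  have hbudget : ((R ∪ familyVertices 𝓐).card : ℝ) + ℓ * 𝓣.length ≤ β * Fintype.card V := by
    have hle : ((R ∪ familyVertices 𝓐).card : ℝ) ≤ R.card + 2 * m * 𝓐.card := by
      exact_mod_cast h𝓐.card_union_vertices_le
    rw [hlen] at hle hR
    push_cast at hle hR
    have : (0 : ℝ) ≤ ℓ := Nat.cast_nonneg ℓ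
    linarith
  obtain ⟨L, rfl, hlink, hLnd, hLR, hLlen⟩ := hH.exists_isLinked habs hbudget
  have hTnd : (T :: L.map Prod.snd).Nodup := hT𝓣 ▸ 𝓐.nodup_toList
  have hflat : (T :: L.map Prod.snd).flatten.Nodup := by
    refine List.nodup_flatten.2 ⟨fun S hS => (habs S hS).nodup, ?_⟩
    exact hTnd.imp_of_mem fun hS hS' hne => h𝓐.disjoint ((hmem _).1 hS) ((hmem _).1 hS') hne
  have hperm := chain_nil_perm m T L
  refine ⟨T, L, ⟨habs, hlink, hTnd, hperm.nodup_iff.2 (hflat.append hLnd ?_)⟩, hmem, ?_, ?_⟩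
  · intro v hv hvL
    obtain ⟨S, hS, hvS⟩ := List.mem_flatten.1 hv
    exact hLR v hvL (Finset.mem_union_right _ (mem_familyVertices.2 ⟨S, (hmem S).1 hS, hvS⟩))
  · intro v hv
    rcases List.mem_append.1 (hperm.mem_iff.1 hv) with hv | hv
    · obtain ⟨S, hS, hvS⟩ := List.mem_flatten.1 hv
      exact h𝓐.avoids S ((hmem S).1 hS) v hvS
    · exact fun hvR => hLR v hv (Finset.mem_union_left _ hvR)
  · have hflatlen : (T :: L.map Prod.snd).flatten.length = (L.length + 1) * (2 * m) := by
      rw [List.length_flatten, List.sum_eq_card_nsmul _ (2 * m)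
        (List.forall_mem_map.2 fun S hS => (habs S hS).length_eq)]
      simp
    rw [hperm.length_eq, List.length_append, hflatlen, hLlen, hlen, List.length_map]
    nlinarith

theorem HasConnections.hasAbsorbingPaths [Nonempty V] (hH : HasConnections H (k + 1) ℓ β) {t : ℕ}
    {b : ℝ} (ht0 : t ≠ 0) (ht : ⌊2 * γ ^ 2 * Fintype.card V⌋₊ ≤ t)
    (hb : b * (2 * (k + 1) + ℓ) ≤ γ * Fintype.card V / 2) (hγ : γ ^ 2 + γ / 2 ≤ β)
    (hfamily : ∀ R : Finset V, (R.card : ℝ) ≤ γ ^ 2 * Fintype.card V →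
      HasHallFamily H (k + 1) t b R Finset.univ) :
    HasAbsorbingPaths k γ H := by
  classical
  intro R hR
  obtain ⟨𝓐, h𝓐, h𝓐b, hHall⟩ := hfamily R hR
  have hne : 𝓐.Nonempty := by
    obtain ⟨v⟩ := ‹Nonempty V›
    have hcov : 0 < coverage H 𝓐 {v} :=
      hHall {v} (Finset.subset_univ _) (by simpa using Nat.one_le_iff_ne_zero.2 ht0)
    exact (Finset.card_pos.1 hcov).mono (Finset.filter_subset _ _)
  have hsize : (𝓐.card : ℝ) * (2 * (k + 1) + ℓ) ≤ γ * Fintype.card V / 2 := hb.trans' (by gcongr)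
  have hbudget : γ ^ 2 * Fintype.card V + γ * Fintype.card V / 2 ≤ β * Fintype.card V := by
    rw [mul_div_right_comm, ← add_mul]
    gcongr
  obtain ⟨T, L, hTL, hmem, hTR, hlen⟩ := hH.exists_isAbsorberChain h𝓐 hne
    (by push_cast; linarith)
  refine ⟨chain (k + 1) (fun _ => []) T L, hTL.isPowerPath_chain (fun S hS => ?_) hTL.nodup, hTR,
    hsize.trans' (by exact_mod_cast hlen), fun U hU => ?_⟩
  · simpa only [insertMiddle_nil] using (hTL.isAbsorber S hS).isPowerWalk
  have hUt : U.card ≤ t := (Nat.le_floor hU).trans ht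
  obtain ⟨φ, hφ, hφU⟩ := exists_injOn_absorbs (U := U.filter (· ∉ chain (k + 1) (fun _ => []) T L))
    fun U' hU' => hHall U' (Finset.subset_univ _)
      ((Finset.card_le_card (hU'.trans (Finset.filter_subset _ _))).trans hUt)
  obtain ⟨B, hB, hBmem, hBends⟩ := hTL.exists_absorbing hφ
    (fun v hv => ⟨(hmem _).2 (hφU v hv).1, (hφU v hv).2⟩) fun v hv => (Finset.mem_filter.1 hv).2
  refine ⟨B, hB, fun v => ?_, hBends⟩
  rw [hBmem, Finset.mem_filter]
  tauto

end Chains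

section Degree

variable {V : Type*} {G : SimpleGraph V} {k m : ℕ} {β β' ε : ℝ}

theorem HasCommonNbrs.compl [Finite V] {R : Finset V} (h : HasCommonNbrs G Set.univ Set.univ m β)
    (hR : R.card + β' ≤ β) : HasCommonNbrs G (R : Set V)ᶜ Set.univ m β' := by
  intro l hl hY
  have hsub : {w | w ∈ Set.univ ∧ ∀ a ∈ l, G.Adj a w} ⊆
      {w | w ∈ (R : Set V)ᶜ ∧ ∀ a ∈ l, G.Adj a w} ∪ R := fun w hw => by
    by_cases hwR : w ∈ R
    exacts [Or.inr hwR, Or.inl ⟨hwR, hw.2⟩]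
  have hcard := (Set.ncard_le_ncard hsub).trans (Set.ncard_union_le _ _)
  rw [Set.ncard_coe_finset] at hcard
  have : ({w | w ∈ Set.univ ∧ ∀ a ∈ l, G.Adj a w}.ncard : ℝ) ≤
    {w | w ∈ (R : Set V)ᶜ ∧ ∀ a ∈ l, G.Adj a w}.ncard + R.card := mod_cast hcard
  linarith [h l hl hY]

variable [Fintype V]

theorem card_sub_le_ncard_forall_adj {δ : ℝ}
    (hG : ∀ v, Fintype.card V - δ ≤ (G.neighborSet v).ncard) (l : List V) :
    Fintype.card V - l.length * δ ≤ {w | ∀ a ∈ l, G.Adj a w}.ncard := by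
  induction l with
  | nil => simp
  | cons b l ih =>
    have hinter : {w | ∀ a ∈ b :: l, G.Adj a w} = G.neighborSet b ∩ {w | ∀ a ∈ l, G.Adj a w} := by
      ext w
      simp
    have hunion : (G.neighborSet b ∪ {w | ∀ a ∈ l, G.Adj a w}).ncard ≤ Fintype.card V := by
      rw [← Nat.card_eq_fintype_card, ← Set.ncard_univ]
      exact Set.ncard_le_ncard (Set.subset_univ _)
    have hcard : ((G.neighborSet b).ncard : ℝ) + {w | ∀ a ∈ l, G.Adj a w}.ncard ≤
        Fintype.card V + {w | ∀ a ∈ b :: l, G.Adj a w}.ncard := by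
      rw [hinter]
      exact_mod_cast (Set.ncard_union_add_ncard_inter _ _).ge.trans (by gcongr)
    rw [List.length_cons, Nat.cast_succ]
    linarith [hG b]

theorem hasCommonNbrs_of_minDegree [DecidableRel G.Adj] (hε : 0 ≤ ε)
    (hG : ((k : ℝ) / (k + 1) + ε) * Fintype.card V ≤ G.minDegree) :
    HasCommonNbrs G Set.univ Set.univ (k + 1) (ε * Fintype.card V) := by
  intro l hl _
  have hmin : (G.minDegree : ℝ) ≤ Fintype.card V := by
    rcases isEmpty_or_nonempty V with _ | _
    · simp
    · exact_mod_cast (G.minDegree_lt_card).le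
  have hcommon := card_sub_le_ncard_forall_adj (G := G) (δ := Fintype.card V - G.minDegree)
    (fun v => ?_) l
  · have hl' : (l.length : ℝ) ≤ k + 1 := mod_cast hl
    simp only [Set.mem_univ, true_and]
    refine hcommon.trans' ?_
    calc ε * Fintype.card V
      _ ≤ (k + 1) * (ε * Fintype.card V) := le_mul_of_one_le_left (by positivity) (by simp)
      _ = Fintype.card V - (k + 1) * (Fintype.card V - (k / (k + 1) + ε) * Fintype.card V) := by
          field_simp
          ring
      _ ≤ Fintype.card V - l.length * (Fintype.card V - G.minDegree) := by
          gcongr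
  · rw [sub_sub_cancel, Set.ncard_eq_toFinset_card', Set.toFinset_card,
      G.card_neighborSet_eq_degree]
    exact_mod_cast G.minDegree_le_degree v

end Degree

section Events

variable {V : Type*} {G F : SimpleGraph V} {k m : ℕ} {α c : ℝ}

/-- The families of connections between the tuples `i.2.1` and `i.2.2` outside the set `i.1`. -/
def connectionFamily {ι : Type*} (G : SimpleGraph V) (m : ℕ) (π : List ι) (M : List (ι × ι))
    (i : Finset V × (Fin m → V) × (Fin m → V)) : Set (ι → V) :=
  connections G M m (i.1 : Set V)ᶜ π (List.ofFn i.2.1) (List.ofFn i.2.2)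

theorem exists_ofFn_eq {α : Type*} {x : List α} (hx : x.length = m) :
    ∃ f : Fin m → α, List.ofFn f = x := by
  subst hx
  exact ⟨x.get, List.ofFn_get x⟩

theorem HasManyConnections.hasConnections [Fintype V] {ι : Type*} [Fintype ι] {π : List ι}
    {M : List (ι × ι)} (hπ : π.Nodup) (hmany : HasManyConnections V m π M α c)
    (hG : HasCommonNbrs G Set.univ Set.univ m (2 * α * Fintype.card V))
    (hF : MeetsRichFamilies F M c (connectionFamily G m π M)) :
    HasConnections (G ⊔ F) m π.length α := by
  intro R hR x z hx hz hxH hzH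
  obtain ⟨x, rfl⟩ := exists_ofFn_eq hx
  obtain ⟨z, rfl⟩ := exists_ofFn_eq hz
  obtain ⟨f, ⟨⟨hfR, hf⟩, hf_inj⟩, hfM⟩ := hF (R, x, z)
    (hmany G _ _ (Set.subset_univ _) (hG.compl (by linarith)) _ _ hx hz (by simp) (by simp))
  refine ⟨π.map f, by simp, hπ.map hf_inj, List.forall_mem_map.2 fun i _ => hfR i, ?_⟩
  exact hf _ le_sup_left (fun e he => Or.inr (hfM e he)) hxH hzH

/-- The tuple `f` of `2 m` vertices as a list. -/
def absorberList (f : Fin m ⊕ Fin m → V) : List V :=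
  List.ofFn (f ∘ Sum.inl) ++ List.ofFn (f ∘ Sum.inr)

/-- The `k`-walks on `2 (k + 1)` vertices outside the set `i.1` that lie in the neighbourhood of a
proportion `c` of the set `i.2`. -/
def absorberFamily (G : SimpleGraph V) (k : ℕ) (c : ℝ) (i : Finset V × Finset V) :
    Set (Fin (k + 1) ⊕ Fin (k + 1) → V) :=
  {f | (∀ a, f a ∉ i.1) ∧ IsPowerWalk G.Adj k (absorberList f) ∧
    c * i.2.card ≤ {v ∈ i.2 | Absorbs G (absorberList f) v}.card}

theorem forall_mem_absorberList {f : Fin m ⊕ Fin m → V} {P : V → Prop} :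
    (∀ a ∈ absorberList f, P a) ↔ ∀ i, P (f i) := by
  simp [absorberList, or_imp, forall_and]

theorem ofFn_comp_finSumFinEquiv_symm (f : Fin m ⊕ Fin m → V) :
    List.ofFn (f ∘ finSumFinEquiv.symm) = absorberList f := by
  rw [absorberList, ← List.ofFn_fin_append]
  exact congr_arg List.ofFn (funext (Fin.addCases (by simp) fun i => by
    rw [Fin.append_right]
    simp only [Function.comp_apply, finSumFinEquiv_symm_apply_natAdd]))

theorem le_ncard_paths_in_neighborSet [Finite V] {R : Finset V} {β : ℝ} (hβ : 0 ≤ β)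
    (hG : HasCommonNbrs G (R : Set V)ᶜ Set.univ (k + 1) β) (v : V) :
    β ^ (2 * (k + 1)) ≤ {f : Fin (k + 1) ⊕ Fin (k + 1) → V | (∀ a, f a ∉ R) ∧
      IsPowerWalk G.Adj k (absorberList f) ∧ Absorbs G (absorberList f) v}.ncard := by
  have hpaths := le_ncard_walk_extensions (N := k + 1 + (k + 1)) (x := []) (c := [v]) hβ
    (Set.subset_univ _) hG (by simp) (by simp)
  rw [← ncard_preimage_equiv (Equiv.arrowCongr finSumFinEquiv (Equiv.refl V))] at hpaths
  rw [two_mul]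
  refine hpaths.trans (Nat.cast_le.2 (Set.ncard_le_ncard fun f ⟨hf, hwalk⟩ => ?_))
  have hf : ∀ i, f i ∉ R ∧ G.Adj v (f i) := finSumFinEquiv.symm.forall_congr_right.1
    fun i => ⟨(hf i).1, (hf i).2 v (by simp)⟩
  refine ⟨fun i => (hf i).1, ?_, forall_mem_absorberList.2 fun i => (hf i).2⟩
  rw [← ofFn_comp_finSumFinEquiv_symm]
  exact hwalk G le_rfl isPowerWalk_nil

theorem le_ncard_rich_of_forall_mem {A B : Type*} [Fintype A] {W : Finset B} (hW : W.Nonempty)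
    {Q : B → A → Prop} (hc : 0 ≤ c) (hQ : ∀ b ∈ W, c * Fintype.card A ≤ {a | Q b a}.ncard) :
    c / 2 * Fintype.card A ≤ {a | c / 2 * W.card ≤ {b | b ∈ W ∧ Q b a}.ncard}.ncard := by
  have : Nonempty W := hW.to_subtype
  have hpairs := mul_le_ncard_of_fiber (S := {x : W × A | Q x.1 x.2}) (T := Set.univ)
    (c := W.card) (by positivity) (by simp [Set.ncard_univ]) fun b _ => hQ b b.2
  rw [← ncard_preimage_equiv (Equiv.prodComm A W)] at hpairs
  have hrich := le_ncard_rich_fiber hc (hpairs.trans_eq' (by rw [Fintype.card_coe]; ring))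
  rw [Fintype.card_coe] at hrich
  refine hrich.trans (Nat.cast_le.2 (Set.ncard_le_ncard fun a ha =>
    le_trans (Set.mem_ofPred.1 ha) (Nat.cast_le.2 ?_)))
  exact Set.ncard_le_ncard_of_injOn Subtype.val (fun b hb => ⟨b.2, hb⟩)
    Subtype.val_injective.injOn (W.finite_toSet.subset fun b hb => hb.1)

theorem le_ncard_absorberFamily [Fintype V] (hα : 0 < α) {R W : Finset V} (hW : W.Nonempty)
    (hG : HasCommonNbrs G (R : Set V)ᶜ Set.univ (k + 1) (α * Fintype.card V)) :
    α ^ (2 * (k + 1)) / 2 * (Fintype.card V : ℝ) ^ (2 * (k + 1)) ≤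
      (absorberFamily G k (α ^ (2 * (k + 1)) / 2) (R, W)).ncard := by
  have hcard : (Fintype.card (Fin (k + 1) ⊕ Fin (k + 1) → V) : ℝ) =
      (Fintype.card V : ℝ) ^ (2 * (k + 1)) := by
    simp [two_mul]
  have hrich := le_ncard_rich_of_forall_mem (c := α ^ (2 * (k + 1))) hW (by positivity) fun v _ =>
    (le_ncard_paths_in_neighborSet (by positivity) hG v).trans_eq' (by rw [hcard, mul_pow])
  rw [hcard] at hrich
  refine hrich.trans (Nat.cast_le.2 (Set.ncard_le_ncard fun f hf => ?_))
  have hpos : (0 : ℝ) < α ^ (2 * (k + 1)) / 2 * W.card := by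
    have := hW.card_pos
    positivity
  obtain ⟨v, -, hfR, hwalk, -⟩ := Set.nonempty_of_ncard_ne_zero
    (Nat.cast_pos.1 (hpos.trans_le hf)).ne'
  refine ⟨hfR, hwalk, hf.trans (Nat.cast_le.2 ?_)⟩
  rw [← Set.ncard_coe_finset]
  exact Set.ncard_le_ncard fun v hv => Finset.mem_filter.2 ⟨hv.1, hv.2.2.2⟩

theorem isPowerWalk_absorberList {f : Fin (k + 1) ⊕ Fin (k + 1) → V}
    (hf : IsPowerWalk G.Adj k (absorberList f))
    (hF : ∀ e ∈ crossMatching id, F.Adj (f e.1) (f e.2)) :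
    IsPowerWalk (G ⊔ F).Adj (k + 1) (absorberList f) := by
  have hwalk : IsPowerWalk (G ⊔ F).Adj k (absorberList f) := fun i j a b hij hjk ha hb =>
    Or.inl (hf i j a b hij hjk ha hb)
  have hhead := hwalk.of_isInfix (List.prefix_append _ _).isInfix
  refine IsPowerWalk.append_of_forall₂ (P := []) (Q := List.ofFn (f ∘ Sum.inl))
    (isPowerWalk_of_pairwise (hhead.pairwise (by simp))) hwalk (List.length_ofFn ..) ?_
  refine List.forall₂_iff_get.2 ⟨by simp, fun i hi _ => ?_⟩
  rw [List.length_ofFn] at hi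
  have hadj : (G ⊔ F).Adj (f (Sum.inl ⟨i, hi⟩)) (f (Sum.inr ⟨i, hi⟩)) :=
    Or.inr (hF _ ((List.mem_ofFn' _ _).2 ⟨⟨i, hi⟩, rfl⟩))
  simpa only [List.get_eq_getElem, List.getElem_ofFn, Function.comp_apply] using hadj

theorem hasAbsorbers_sup [Fintype V] (hα : 0 < α)
    (hG : HasCommonNbrs G Set.univ Set.univ (k + 1) (2 * α * Fintype.card V))
    (hF : MeetsRichFamilies F (crossMatching id) (α ^ (2 * (k + 1)) / 2)
      (absorberFamily G k (α ^ (2 * (k + 1)) / 2))) :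
    HasAbsorbers (G ⊔ F) (k + 1) (α ^ (2 * (k + 1)) / 2) α := by
  intro R hR W hW
  obtain ⟨f, ⟨⟨hfR, hwalk, hfW⟩, hf_inj⟩, hfM⟩ := hF (R, W) (by
    simpa [two_mul] using le_ncard_absorberFamily hα hW (hG.compl (by linarith)))
  refine ⟨absorberList f, ⟨?_, ?_, isPowerWalk_absorberList hwalk hfM⟩,
    forall_mem_absorberList.2 hfR, hfW.trans (Nat.cast_le.2 (Finset.card_le_card ?_))⟩
  · rw [absorberList, List.length_append, List.length_ofFn, List.length_ofFn, two_mul]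
  · rw [← ofFn_comp_finSumFinEquiv_symm]
    exact List.nodup_ofFn.2 (hf_inj.comp finSumFinEquiv.symm.injective)
  · exact Finset.monotone_filter_right _ fun v _ hv a ha => Or.inl (hv a ha)

end Events

theorem le_two_pow_mul_floor {n g : ℕ} (hn : 1 ≤ ((1 / 2 : ℝ) ^ g) ^ 2 * n) :
    n ≤ 2 ^ (2 * g) * ⌊2 * ((1 / 2 : ℝ) ^ g) ^ 2 * n⌋₊ := by
  have hfloor := Nat.lt_floor_add_one (2 * ((1 / 2 : ℝ) ^ g) ^ 2 * n)
  have : (n : ℝ) ≤ 2 ^ (2 * g) * ⌊2 * ((1 / 2 : ℝ) ^ g) ^ 2 * n⌋₊ := by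
    calc (n : ℝ)
      _ = 2 ^ (2 * g) * (((1 / 2 : ℝ) ^ g) ^ 2 * n) := by
        rw [← pow_mul, mul_comm g 2, ← mul_assoc, ← mul_pow, mul_one_div_cancel two_ne_zero,
          one_pow, one_mul]
      _ ≤ 2 ^ (2 * g) * ⌊2 * ((1 / 2 : ℝ) ^ g) ^ 2 * n⌋₊ := by
        gcongr
        linarith
  exact_mod_cast this

theorem hasAbsorbingPaths_of_absorbers_of_connections {V : Type*} [Fintype V] {H : SimpleGraph V}
    {k ℓ g : ℕ} {c α : ℝ} (hc : 0 < c) (hc1 : c ≤ 1) (hA : HasAbsorbers H (k + 1) c α)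
    (hC : HasConnections H (k + 1) ℓ α) (hg1 : (1 / 2 : ℝ) ^ g ≤ 1 / 2)
    (hgα : (1 / 2 : ℝ) ^ g ≤ α)
    (hg : (6 + 6 * g) * (4 * (2 * (k + 1) + ℓ) / c) * (1 / 2 : ℝ) ^ g ≤ 1)
    (hn : 1 ≤ ((1 / 2 : ℝ) ^ g) ^ 2 * Fintype.card V) :
    HasAbsorbingPaths k ((1 / 2 : ℝ) ^ g) H := by
  set γ : ℝ := (1 / 2 : ℝ) ^ g
  set n : ℝ := (Fintype.card V : ℝ)
  set t : ℕ := ⌊2 * γ ^ 2 * n⌋₊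
  have hγ0 : 0 < γ := by positivity
  have hβ : γ ^ 2 + γ / 2 ≤ α := by nlinarith
  have ht : (t : ℝ) ≤ 2 * γ ^ 2 * n := Nat.floor_le (by positivity)
  have hsize : (6 + 3 * (2 * g : ℕ)) * t / c * (2 * (k + 1) + ℓ) ≤ γ * n / 2 := by
    calc (6 + 3 * (2 * g : ℕ)) * t / c * (2 * (k + 1) + ℓ)
      _ ≤ (6 + 3 * (2 * g : ℕ)) * (2 * γ ^ 2 * n) / c * (2 * (k + 1) + ℓ) := by gcongr
      _ = (6 + 6 * g) * (4 * (2 * (k + 1) + ℓ) / c) * γ * (γ * n / 2) := by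
        push_cast
        ring
      _ ≤ γ * n / 2 := mul_le_of_le_one_left (by positivity) hg
  have hcard : Fintype.card V ≤ 2 ^ (2 * g) * t := le_two_pow_mul_floor hn
  have hV : 0 < Fintype.card V :=
    Nat.cast_pos.1 (pos_of_mul_pos_right (one_pos.trans_le hn) (by positivity))
  have : Nonempty V := Fintype.card_pos_iff.1 hV
  have ht0 : t ≠ 0 := right_ne_zero_of_mul (hV.trans_le hcard).ne'
  refine hC.hasAbsorbingPaths ht0 le_rfl hsize hβ fun R hR =>
    hA.hasHallFamily k.succ_ne_zero hc hc1 hcard ?_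
  have hle : 2 * ((k + 1 : ℕ) : ℝ) * ((6 + 3 * (2 * g : ℕ)) * t / c) ≤ γ * n / 2 := by
    refine hsize.trans' ?_
    rw [Nat.cast_succ, mul_comm]
    gcongr
    exact le_add_of_nonneg_right ℓ.cast_nonneg
  linarith [mul_le_mul_of_nonneg_right hβ ((Fintype.card V).cast_nonneg (α := ℝ))]

theorem exists_small_exponent (D : ℝ) {δ : ℝ} (hδ : 0 < δ) :
    ∃ g : ℕ, (6 + 6 * g) * D * (1 / 2 : ℝ) ^ g ≤ 1 ∧ (1 / 2 : ℝ) ^ g < δ := by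
  have hhalf : |(1 / 2 : ℝ)| < 1 := by norm_num [abs_of_pos]
  have hpow := tendsto_pow_atTop_nhds_zero_of_abs_lt_one hhalf
  have hlin := (hpow.const_mul (6 * D)).add
    ((tendsto_pow_const_mul_const_pow_of_abs_lt_one 1 hhalf).const_mul (6 * D))
  simp only [pow_one, mul_zero, add_zero] at hlin
  obtain ⟨g, hg, hgδ⟩ := ((hlin.eventually_lt_const one_pos).and
    (hpow.eventually_lt_const hδ)).exists
  exact ⟨g, by linarith, hgδ⟩

section Limits

open Filter Topology MeasureTheory SimpleGraph

theorem tendsto_measure_not_of_imp {ι : Type*} {l : Filter ι} {Ω : ι → Type*}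
    [∀ i, MeasurableSpace (Ω i)] {μ : ∀ i, Measure (Ω i)} {P Q : ∀ i, Ω i → Prop}
    (hP : Tendsto (fun i => μ i {ω | ¬ P i ω}) l (𝓝 0))
    (h : ∀ᶠ i in l, ∀ ω, P i ω → Q i ω) : Tendsto (fun i => μ i {ω | ¬ Q i ω}) l (𝓝 0) :=
  tendsto_of_tendsto_of_tendsto_of_le_of_le' tendsto_const_nhds hP
    (.of_forall fun _ => zero_le) (h.mono fun _ hi => measure_mono fun _ => mt (hi _))

theorem tendsto_measure_one_of_imp {ι : Type*} {l : Filter ι} {Ω : ι → Type*}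
    [∀ i, MeasurableSpace (Ω i)] {μ : ∀ i, Measure (Ω i)} [∀ i, IsProbabilityMeasure (μ i)]
    {P Q S : ∀ i, Ω i → Prop} (hP : Tendsto (fun i => μ i {ω | ¬ P i ω}) l (𝓝 0))
    (hQ : Tendsto (fun i => μ i {ω | ¬ Q i ω}) l (𝓝 0))
    (h : ∀ᶠ i in l, ∀ ω, P i ω → Q i ω → S i ω) :
    Tendsto (fun i => μ i {ω | S i ω}) l (𝓝 1) := by
  have hlim := ENNReal.Tendsto.sub (tendsto_const_nhds (x := 1)) (hP.add hQ)
    (.inl ENNReal.one_ne_top)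
  rw [add_zero, tsub_zero] at hlim
  refine tendsto_of_tendsto_of_tendsto_of_le_of_le' hlim tendsto_const_nhds (h.mono fun i hi => ?_)
    (.of_forall fun _ => prob_le_one)
  rw [tsub_le_iff_right, ← measure_univ (μ := μ i)]
  refine (measure_mono fun ω _ => ?_).trans ((measure_union_le {ω | S i ω} _).trans
    (add_le_add_right (measure_union_le {ω | ¬ P i ω} {ω | ¬ Q i ω}) _))
  by_cases hω : P i ω ∧ Q i ω
  · exact .inl (hi ω hω.1 hω.2)
  · exact .inr (not_and_or.1 hω)

theorem exists_tendsto_not_hasConnections (k : ℕ) {α : ℝ} (hα : 0 < α) :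
    ∃ (ℓ : ℕ) (C : ℝ), ∀ (G : ∀ n, SimpleGraph (Fin n)) (p : ℕ → unitInterval),
      (∀ᶠ n : ℕ in atTop, HasCommonNbrs (G n) Set.univ Set.univ (k + 1) (2 * α * n)) →
      (∀ᶠ n : ℕ in atTop, C / n ≤ (p n : ℝ)) →
      Tendsto (fun n => binomialRandom (Fin n) (p n)
        {F | ¬ HasConnections (G n ⊔ F) (k + 1) ℓ α}) atTop (𝓝 0) := by
  obtain ⟨ι, _, π, M, -, hπ, hM, -, hcount⟩ := exists_connecting_pattern k
  obtain ⟨c, hc, hcount⟩ := hcount α hα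
  obtain ⟨C, hC⟩ := exists_tendsto_not_meetsRichFamilies hM hc (2 * (k + 1))
  refine ⟨π.length, C, fun G p hG hp => tendsto_measure_not_of_imp
    (hC p _ (fun n => connectionFamily (G n) (k + 1) π M) hp fun n => ?_)
    (hG.mono fun n hGn F hF => (hcount (Fin n)).hasConnections hπ (by simpa using hGn) hF)⟩
  simp only [Fintype.card_prod, Fintype.card_finset, Fintype.card_fun, Fintype.card_fin]
  rw [two_mul, pow_add n (k + 1) (k + 1)]
  gcongr
  norm_num

theorem exists_tendsto_not_hasAbsorbers (k : ℕ) {α : ℝ} (hα : 0 < α) :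
    ∃ C : ℝ, ∀ (G : ∀ n, SimpleGraph (Fin n)) (p : ℕ → unitInterval),
      (∀ᶠ n : ℕ in atTop, HasCommonNbrs (G n) Set.univ Set.univ (k + 1) (2 * α * n)) →
      (∀ᶠ n : ℕ in atTop, C / n ≤ (p n : ℝ)) →
      Tendsto (fun n => binomialRandom (Fin n) (p n)
        {F | ¬ HasAbsorbers (G n ⊔ F) (k + 1) (α ^ (2 * (k + 1)) / 2) α}) atTop (𝓝 0) := by
  obtain ⟨C, hC⟩ := exists_tendsto_not_meetsRichFamilies
    (isMatching_crossMatching Function.injective_id) (by positivity : 0 < α ^ (2 * (k + 1)) / 2) 0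
  refine ⟨C, fun G p hG hp => tendsto_measure_not_of_imp
    (hC p _ (fun n => absorberFamily (G n) k _) hp fun n => ?_)
    (hG.mono fun n hGn F hF => hasAbsorbers_sup hα (by simpa using hGn) hF)⟩
  simp only [Fintype.card_prod, Fintype.card_finset, Fintype.card_fin]
  rw [← mul_pow]
  norm_num

end Limits

end PowerPath

theorem proposition2p3 (k : ℕ) (ε : ℝ) (hε : 0 < ε) :
    ∃ γ : ℝ, 0 < γ ∧ γ < ε / 4 ^ (k + 2) ∧ ∃ C : ℝ, 1 < C ∧
      ∀ (G : (n : ℕ) → SimpleGraph (Fin n)) [∀ n, DecidableRel (G n).Adj] (p : ℕ → unitInterval),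
        (∀ᶠ n : ℕ in Filter.atTop,
          ((k : ℝ) / ((k : ℝ) + 1) + ε) * (n : ℝ) ≤ ((G n).minDegree : ℝ)) →
        (∀ᶠ n : ℕ in Filter.atTop, C / (n : ℝ) ≤ (p n : ℝ)) →
        Filter.Tendsto
          (fun n : ℕ => SimpleGraph.binomialRandom (Fin n) (p n)
            {F : SimpleGraph (Fin n) | PowerPath.HasAbsorbingPaths k γ (G n ⊔ F)})
          Filter.atTop (nhds 1) := by
  open PowerPath in
  obtain ⟨α, hα0, hα1, hαε⟩ : ∃ α : ℝ, 0 < α ∧ α ≤ 1 ∧ 2 * α ≤ ε :=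
    ⟨min ε 1 / 2, by positivity, by linarith [min_le_right ε 1], by linarith [min_le_left ε 1]⟩
  obtain ⟨ℓ, C₁, hconn⟩ := exists_tendsto_not_hasConnections k hα0
  obtain ⟨C₂, habs⟩ := exists_tendsto_not_hasAbsorbers k hα0
  have hc1 : α ^ (2 * (k + 1)) / 2 ≤ 1 := by linarith [pow_le_one₀ hα0.le hα1 (n := 2 * (k + 1))]
  obtain ⟨g, hg, hgδ⟩ := exists_small_exponent
    (4 * (2 * (k + 1) + ℓ) / (α ^ (2 * (k + 1)) / 2))
    (δ := min (ε / 4 ^ (k + 2)) (min α (1 / 2))) (by positivity)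
  rw [lt_min_iff, lt_min_iff] at hgδ
  refine ⟨(1 / 2) ^ g, by positivity, hgδ.1, max (max C₁ C₂) 2, by simp, fun G _ p hdeg hp => ?_⟩
  have hG : ∀ᶠ n : ℕ in .atTop,
      HasCommonNbrs (G n) Set.univ Set.univ (k + 1) (2 * α * n) := hdeg.mono fun n hn => by
    simpa using hasCommonNbrs_of_minDegree (ε := 2 * α) (G := G n) (by positivity)
      (hn.trans' (by rw [Fintype.card_fin]; gcongr))
  refine tendsto_measure_one_of_imp
    (hconn G p hG (hp.mono fun n hn => hn.trans' (by gcongr; simp)))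
    (habs G p hG (hp.mono fun n hn => hn.trans' (by gcongr; simp))) ?_
  filter_upwards [tendsto_natCast_atTop_atTop.eventually_ge_atTop (1 / ((1 / 2 : ℝ) ^ g) ^ 2)]
    with n hn F hF hF'
  exact hasAbsorbingPaths_of_absorbers_of_connections (by positivity) hc1 hF' hF hgδ.2.2.le
    hgδ.2.1.le hg (by rwa [Fintype.card_fin, ← div_le_iff₀' (by positivity)])
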